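/- Let $c>0$, $\tau>0$, $b=c\tau$. For real $t,x,y,z$ put $\rho=\sqrt{x^2+y^2}$, $S=\sqrt{c^2(t+i\tau)^2-\rho^2}$, where the branch of the square root is the continuous one with $S=c(t+i\tau)$ on the axis $\rho=0$, and $\theta=S-z-ib$ (so that $\operatorname{Im}\theta\ge 0$). Let $J_0(m)=\frac1{2\pi}\int_0^{2\pi}e^{im\cos\mu}\,d\mu$ and $\mathbb C^+=\{\operatorname{Im}\theta>0\}$. A waveform is a function $f$ that is analytic in $\mathbb C^+$ and satisfies $|f(\theta)|\le C/(1+|\theta|)$ there for some constant $C$. A function $\hat f$ on $(0,\infty)$ is called an amplitude of $f$ if $$f(\theta)=\int_0^\infty \hat f(\kappa)\,e^{i\kappa\theta}\,d\kappa \qquad (1)$$ with absolute convergence for every $\theta\in\mathbb C^+$. At real $\theta$, formula (1) is understood as $\lim_{K\to\infty}\int_0^K$. 1. Every waveform $f$ has an amplitude $\hat f$, unique up to equality almost everywhere on $(0,\infty)$. If moreover $f$ is continuous in $\{\operatorname{Im}\theta\ge0\}$, then (1) also holds at every real point at which the restriction of $f$ to the real line is differentiable. 2. Conversely, every $\hat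 f\in L^p(0,\infty)$ with $1\le p<\infty$ is an amplitude of a function $f$ analytic in $\mathbb C^+$. 3. Let $\hat f$ be an amplitude of $f$, where $f$ is a waveform or $\hat f\in L^p(0,\infty)$ for some $1\le p<\infty$. Then at every point $(t,x,y,z)$ with $\rho>0$, and at every point with $\rho=0$ such that (1) holds at the corresponding real $\theta=ct-z$, the quasi-spherical wave $u=f(\theta)/S$ is $$u=-i\int_0^\infty e^{ik(ct+ib)}\,dk\int_0^k \hat f(k_z)\,J_0\!\left(\sqrt{k^2-k_z^2}\,\rho\right)e^{-ik_z(z+ib)}\,dk_z$$ and is the Fourier–Bessel integral $$u=\int_0^\infty d\omega\, e^{i\omega t}\int_0^{\omega/c}dk_z\,A(k_z,\omega)\,e^{-ik_zz}J_0\!\left(\rho\sqrt{\omega^2/c^2-k_z^2}\right),\qquad A(k_z,\omega)=-\frac ic\,e^{-(\omega/c-k_z)b}\,\hat f(k_z).$$ Here the inner integrals, and the outer integrals over bounded intervals, are Lebesgue integrals of integrable functions, and the outer integrals over $(0,\infty)$ are the limits of those over $(0,K)$, $(0,\Omega)$ as $K,\Omega\to\infty$. 4. If in addition $\hat f\in L^1(0,\infty)$,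 then at the same points the last double integral converges absolutely and $u$ equals it as a Lebesgue integral. -/

import Mathlib

open MeasureTheory Filter Topology Set
open scoped ENNReal

noncomputable section

/-- The axial distance `ρ = √(x² + y²)`. -/
def axialDist (x y : ℝ) : ℝ := Real.sqrt (x ^ 2 + y ^ 2)

/-- The complex time `t_* = t + iτ`. -/
def complexTime (τ t : ℝ) : ℂ := (t : ℂ) + Complex.I * (τ : ℂ)

/-- `S = √(c² t_*² - ρ²)`, with the continuous branch of the square root that equals `c t_*` on the
axis `x = y = 0`. It is written as `i √(ρ² - c² t_*²)` with the principal square root, whose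
argument never meets the cut; the three lemmas below say that this is the branch in question. -/
def waveS (c τ t x y : ℝ) : ℂ :=
  Complex.I * (((axialDist x y : ℂ) ^ 2 - (c : ℂ) ^ 2 * complexTime τ t ^ 2) ^ (1 / 2 : ℂ))

lemma waveS_sq (c τ t x y : ℝ) :
    waveS c τ t x y ^ 2 = (c : ℂ) ^ 2 * complexTime τ t ^ 2 - (axialDist x y : ℂ) ^ 2 := by
  have h := Complex.cpow_nat_inv_pow
    ((axialDist x y : ℂ) ^ 2 - (c : ℂ) ^ 2 * complexTime τ t ^ 2) (n := 2) two_ne_zero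
  have e : (1 / 2 : ℂ) = ((2 : ℕ) : ℂ)⁻¹ := by norm_num
  rw [waveS, mul_pow, Complex.I_sq, e, h]
  ring

lemma waveS_axis (c τ t : ℝ) (hc : 0 < c) (hτ : 0 < τ) :
    waveS c τ t 0 0 = (c : ℂ) * complexTime τ t := by
  set v : ℂ := (c * τ : ℝ) - Complex.I * (c * t : ℝ) with hv
  have hre : 0 < v.re := by simp [hv]; positivity
  have hsq : (axialDist 0 0 : ℂ) ^ 2 - (c : ℂ) ^ 2 * complexTime τ t ^ 2 = v ^ 2 := by
    simp only [axialDist, complexTime, hv]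
    push_cast
    simp
    linear_combination (-(c : ℂ) ^ 2 * (τ : ℂ) ^ 2 - (c : ℂ) ^ 2 * (t : ℂ) ^ 2) * Complex.I_sq
  have harg := Complex.abs_arg_lt_pi_div_two_iff.mpr (Or.inl hre)
  rw [abs_lt] at harg
  have e : (1 / 2 : ℂ) = ((2 : ℕ) : ℂ)⁻¹ := by norm_num
  rw [waveS, hsq, e, Complex.pow_cpow_nat_inv two_ne_zero]
  · simp only [complexTime, hv]
    push_cast
    linear_combination (-(c : ℂ) * (t : ℂ)) * Complex.I_sq
  · push_cast; linarith [harg.1]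
  · push_cast; linarith [harg.2]

lemma waveS_continuous (c τ : ℝ) (hc : 0 < c) (hτ : 0 < τ) :
    Continuous fun q : ℝ × ℝ × ℝ => waveS c τ q.1 q.2.1 q.2.2 := by
  have hbase : Continuous fun q : ℝ × ℝ × ℝ =>
      ((axialDist q.2.1 q.2.2 : ℂ) ^ 2 - (c : ℂ) ^ 2 * complexTime τ q.1 ^ 2) := by
    unfold axialDist complexTime
    fun_prop
  unfold waveS
  refine continuous_const.mul (hbase.cpow continuous_const fun q => ?_)
  rw [Complex.mem_slitPlane_iff]
  have hre : ((axialDist q.2.1 q.2.2 : ℂ) ^ 2 - (c : ℂ) ^ 2 * complexTime τ q.1 ^ 2).re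
      = axialDist q.2.1 q.2.2 ^ 2 - c ^ 2 * (q.1 ^ 2 - τ ^ 2) := by
    simp [complexTime, pow_two]
  have him : ((axialDist q.2.1 q.2.2 : ℂ) ^ 2 - (c : ℂ) ^ 2 * complexTime τ q.1 ^ 2).im
      = - (c ^ 2 * (2 * q.1 * τ)) := by
    simp [complexTime, pow_two]
    left
    ring
  rw [hre, him]
  by_cases ht : q.1 = 0
  · left
    rw [ht]
    have : 0 < c ^ 2 * τ ^ 2 := by positivity
    nlinarith [sq_nonneg (axialDist q.2.1 q.2.2)]
  · right
    exact neg_ne_zero.mpr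
      (mul_ne_zero (pow_ne_zero 2 hc.ne') (mul_ne_zero (mul_ne_zero two_ne_zero ht) hτ.ne'))

/-- The quasi-spherical phase `θ = S - z - ib`, `b = cτ`. -/
def phase (c τ t x y z : ℝ) : ℂ :=
  waveS c τ t x y - (z : ℂ) - Complex.I * ((c * τ : ℝ) : ℂ)

/-- The quasi-spherical wave `f(θ)/S`. -/
def quasiSpherical (c τ : ℝ) (f : ℂ → ℂ) (t x y z : ℝ) : ℂ :=
  f (phase c τ t x y z) / waveS c τ t x y

/-- A waveform: analytic in the open upper half-plane, bounded there, and decreasing at infinity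
no slower than `1/|θ|`. -/
def IsWaveform (f : ℂ → ℂ) : Prop :=
  DifferentiableOn ℂ f {θ : ℂ | 0 < θ.im} ∧
    ∃ C : ℝ, ∀ θ : ℂ, 0 < θ.im → ‖f θ‖ ≤ C / (1 + ‖θ‖)

/-- `F` is the Fourier amplitude `f̂` of the waveform `f`: in the upper half-plane
`f(θ) = ∫₀^∞ F(κ) exp(iκθ) dκ`, the integral being absolutely convergent. -/
def IsFourierAmplitude (f : ℂ → ℂ) (F : ℝ → ℂ) : Prop :=
  ∀ θ : ℂ, 0 < θ.im →
    IntegrableOn (fun κ : ℝ => F κ * Complex.exp (Complex.I * κ * θ)) (Ioi 0) ∧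
    f θ = ∫ κ in Ioi (0 : ℝ), F κ * Complex.exp (Complex.I * κ * θ)

/-- The formula `f(θ) = ∫₀^∞ F(κ) exp(iκθ) dκ` at the single point `θ`, the integral being
understood as `lim ∫₀^K` for `K → ∞`. -/
def AmplitudeFormulaAt (f : ℂ → ℂ) (F : ℝ → ℂ) (θ : ℂ) : Prop :=
  Tendsto (fun K : ℝ => ∫ κ in (0 : ℝ)..K, F κ * Complex.exp (Complex.I * κ * θ)) atTop
    (𝓝 (f θ))

/-- The Bessel function `J₀(m) = (1/2π) ∫₀^{2π} exp(i m cos μ) dμ`. -/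
def besselJ0 (m : ℝ) : ℂ :=
  1 / (2 * (Real.pi : ℂ)) *
    ∫ μ in (0 : ℝ)..(2 * Real.pi), Complex.exp (Complex.I * m * Real.cos μ)

/-- The integrand of the inner (`k_z`) integral of a Fourier-Bessel integral with weight
`A(k_z, ω)`. -/
def fbInner (c : ℝ) (A : ℝ → ℝ → ℂ) (ρ z ω kz : ℝ) : ℂ :=
  A kz ω * Complex.exp (-(Complex.I * kz * z)) *
    besselJ0 (ρ * Real.sqrt (ω ^ 2 / c ^ 2 - kz ^ 2))

/-- The integrand of the outer (`ω`) integral of a Fourier-Bessel integral. -/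
def fbOuter (c : ℝ) (A : ℝ → ℝ → ℂ) (ρ z t ω : ℝ) : ℂ :=
  Complex.exp (Complex.I * ω * t) * ∫ kz in (0 : ℝ)..(ω / c), fbInner c A ρ z ω kz

/-- `u = ∫₀^∞ dω e^{iωt} ∫₀^{ω/c} dk_z A(k_z, ω) e^{-i k_z z} J₀(ρ √(ω²/c² - k_z²))`, where the
inner integral and the outer one over bounded intervals are Lebesgue integrals of integrable
functions, and the outer one over `(0, ∞)` is `lim ∫₀^Ω` for `Ω → ∞`. -/
def HasFourierBessel (c : ℝ) (A : ℝ → ℝ → ℂ) (ρ z t : ℝ) (u : ℂ) : Prop :=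
  (∀ ω : ℝ, 0 < ω → IntervalIntegrable (fbInner c A ρ z ω) volume 0 (ω / c)) ∧
  (∀ Ω : ℝ, 0 < Ω → IntervalIntegrable (fbOuter c A ρ z t) volume 0 Ω) ∧
  Tendsto (fun Ω : ℝ => ∫ ω in (0 : ℝ)..Ω, fbOuter c A ρ z t ω) atTop (𝓝 u)

/-- The same formula with an absolutely convergent double integral. -/
def HasAbsFourierBessel (c : ℝ) (A : ℝ → ℝ → ℂ) (ρ z t : ℝ) (u : ℂ) : Prop :=
  IntegrableOn
    (fun q : ℝ × ℝ => Complex.exp (Complex.I * q.1 * t) * fbInner c A ρ z q.1 q.2)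
    {q : ℝ × ℝ | 0 < q.1 ∧ 0 < q.2 ∧ q.2 < q.1 / c} ∧
  u = ∫ ω in Ioi (0 : ℝ), fbOuter c A ρ z t ω

/-- The integrand of the inner integral of the representation by cylindrical waves. -/
def cylInner (c τ : ℝ) (F : ℝ → ℂ) (ρ z k kz : ℝ) : ℂ :=
  F kz * besselJ0 (Real.sqrt (k ^ 2 - kz ^ 2) * ρ) *
    Complex.exp (-(Complex.I * kz * ((z : ℂ) + Complex.I * ((c * τ : ℝ) : ℂ))))

/-- The integrand of the outer integral of the representation by cylindrical waves. -/
def cylOuter (c τ : ℝ) (F : ℝ → ℂ) (ρ z t k : ℝ) : ℂ :=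
  Complex.exp (Complex.I * k * (((c * t : ℝ) : ℂ) + Complex.I * ((c * τ : ℝ) : ℂ))) *
    ∫ kz in (0 : ℝ)..k, cylInner c τ F ρ z k kz

/-- `u = -i ∫₀^∞ e^{ik(ct+ib)} dk ∫₀^k F(k_z) J₀(√(k² - k_z²) ρ) e^{-i k_z (z+ib)} dk_z` with
`b = cτ`, the integrals being understood as in `HasFourierBessel`. -/
def HasCylindrical (c τ : ℝ) (F : ℝ → ℂ) (ρ z t : ℝ) (u : ℂ) : Prop :=
  (∀ k : ℝ, 0 < k → IntervalIntegrable (cylInner c τ F ρ z k) volume 0 k) ∧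
  (∀ K : ℝ, 0 < K → IntervalIntegrable (cylOuter c τ F ρ z t) volume 0 K) ∧
  Tendsto (fun K : ℝ => -Complex.I * ∫ k in (0 : ℝ)..K, cylOuter c τ F ρ z t k) atTop (𝓝 u)

/-- The weight `A(k_z, ω) = -(i/c) e^{-(ω/c - k_z) b} F(k_z)`, `b = cτ`. -/
def fbWeight (c τ : ℝ) (F : ℝ → ℂ) (kz ω : ℝ) : ℂ :=
  -(Complex.I / c) * (Real.exp (-(ω / c - kz) * (c * τ)) : ℂ) * F kz

end

/-! ### The Bessel function and the Laplace integral of a cylindrical wave -/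

/-! Everything rests on one Laplace integral: for `Re p > 0` and `R = √(ρ² + p²)`, the integral of
`e^{-pk} J₀(ρ√(k² - a²))` over `k > a` is `e^{-aR}/R`. With `p = b - ict` one has `S = iR`, so each
exponential `e^{iaθ}/S` is, up to the factor `-i`, a superposition of cylindrical waves with `k > a`
(`integral_cylWave`). Multiplying by `f̂(a)` and integrating in `a` gives `f(θ)/S`.

The order of integration is exchanged on the triangle `0 < a < k ≤ K`, where local integrability of
`f̂` suffices. The result differs from the truncation of (1) at `K` by the part with `a ≤ K < k`,
which is at most `(1/b) ∫₀^K |f̂(a)| e^{-b(K-a)} da`. This tends to zero for `f̂` in `L^p`, `p < ∞`,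
so the outer integral converges wherever (1) does, in particular on the axis. The frequency form is
the substitution `ω = ck`. For `f̂` in `L¹` the integrand is absolutely integrable over the whole
wedge `a < k`.

Amplitudes of waveforms come from a Paley-Wiener argument. The shift `f(· + iε)` is square
integrable on the real line. Cauchy's formula pairs it with `1/(r - w)`, the Fourier transform of a
half-line exponential, and the multiplication formula moves the transform onto the shift. The `L²`
bounds are uniform in `ε`, and uniqueness of Fourier transforms identifies the amplitudes for
different `ε`. Hence a waveform has an amplitude in `L²`, and the representation is the case `p =
2`.

At a real point `s` of differentiability one may assume `f(s) = 0`. Then `f(r)/(r - s)` is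
integrable, and its Fourier transform is, up to unimodular and constant factors, `∫₀^K f̂(κ) e^{iκs}
dκ`. The Riemann-Lebesgue lemma gives the limit `0 = f(s)`. -/

lemma continuous_besselJ0 : Continuous besselJ0 := by
  unfold besselJ0
  refine continuous_const.mul ?_
  apply intervalIntegral.continuous_parametric_intervalIntegral_of_continuous'
  simp only [Function.uncurry_def]
  fun_prop

lemma norm_besselJ0_le (m : ℝ) : ‖besselJ0 m‖ ≤ 1 := by
  have h : ‖∫ μ in (0 : ℝ)..(2 * Real.pi), Complex.exp (Complex.I * m * Real.cos μ)‖
      ≤ 1 * |2 * Real.pi - 0| := by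
    refine intervalIntegral.norm_integral_le_of_norm_le_const fun μ _ => ?_
    rw [Complex.norm_exp]
    simp [-Complex.ofReal_cos]
  have hp := Real.pi_pos
  rw [one_mul, sub_zero, abs_of_pos (by positivity)] at h
  rw [besselJ0, norm_mul, norm_div]
  have : ‖(2 * (Real.pi : ℂ))‖ = 2 * Real.pi := by
    simp [abs_of_pos hp]
  rw [this, norm_one, div_mul_eq_mul_div, one_mul]
  exact (div_le_one (by positivity)).2 h

/-- The mean of a function over a circle as a contour integral. -/
lemma circleIntegral_inv_smul (g : ℂ → ℂ) {r : ℝ} (hr : r ≠ 0) :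
    (∮ z in C(0, r), (z - 0)⁻¹ • g z)
      = Complex.I * ∫ μ in (0 : ℝ)..(2 * Real.pi), g (circleMap 0 r μ) := by
  rw [circleIntegral, ← intervalIntegral.integral_const_mul]
  refine intervalIntegral.integral_congr fun μ _ => ?_
  have := circleMap_ne_center (c := 0) hr (θ := μ)
  simp only [deriv_circleMap, smul_eq_mul, sub_zero]
  field_simp

lemma exp_I_mul_add_exp_neg (μ : ℝ) (a k : ℂ) :
    (k + a) * Complex.exp (μ * Complex.I) + (k - a) * (Complex.exp (μ * Complex.I))⁻¹
      = 2 * (k * Complex.cos μ + Complex.I * a * Complex.sin μ) := by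
  rw [← Complex.exp_neg, ← neg_mul, Complex.exp_mul_I, Complex.exp_mul_I, Complex.cos_neg,
    Complex.sin_neg]
  ring

/-- An integral representation of `J₀(ρ √(k² - a²))` that is exponential in `k`. -/
lemma besselJ0_sqrt_sub {ρ a k : ℝ} (ha : 0 ≤ a) (hak : a < k) :
    besselJ0 (Real.sqrt (k ^ 2 - a ^ 2) * ρ) = 1 / (2 * (Real.pi : ℂ)) *
      ∫ μ in (0 : ℝ)..(2 * Real.pi),
        Complex.exp (Complex.I * ρ * k * Complex.cos μ - ρ * a * Complex.sin μ) := by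
  -- The function `g` is analytic off the origin, so its means over the circles of radii `1` and `l`
  -- agree. The unit circle gives the exponential form. The radius `l` makes `(k + a) l` and `(k -
  -- a) / l` both equal to `√(k² - a²)`, which gives `J₀`.
  set g : ℂ → ℂ := fun z =>
    Complex.exp (Complex.I * ρ * ((k + a) * z + (k - a) * z⁻¹) / 2) with hg
  have hka : 0 < k - a := by linarith
  have hka' : 0 < k + a := by linarith
  set l : ℝ := Real.sqrt ((k - a) / (k + a)) with hl
  have hl0 : 0 < l := Real.sqrt_pos.2 (by positivity)
  have hl1 : l ≤ 1 := by
    rw [hl, Real.sqrt_le_one, div_le_one hka']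
    linarith
  have hl2 : l ^ 2 = (k - a) / (k + a) := Real.sq_sqrt (by positivity)
  have hsq : Real.sqrt (k ^ 2 - a ^ 2) = (k + a) * l := by
    rw [show k ^ 2 - a ^ 2 = ((k + a) * l) ^ 2 by rw [mul_pow, hl2]; field_simp; ring]
    exact Real.sqrt_sq (by positivity)
  have hd : ∀ z : ℂ, z ≠ 0 → DifferentiableAt ℂ g z := fun z hz => by
    have : DifferentiableAt ℂ (fun z : ℂ => z⁻¹) z := differentiableAt_inv hz
    simp only [hg]
    fun_prop
  have key := Complex.circleIntegral_sub_center_inv_smul_eq_of_differentiable_on_annulus_off_countable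
    (c := 0) hl0 hl1 (f := g) countable_empty
    (fun z hz => (hd z (by
      rintro rfl
      exact hz.2 (by simpa using hl0))).continuousAt.continuousWithinAt)
    (fun z hz => hd z (by
      rintro rfl
      exact hz.1.2 (by simpa using hl0.le)))
  rw [circleIntegral_inv_smul g one_ne_zero, circleIntegral_inv_smul g hl0.ne'] at key
  have key' := mul_left_cancel₀ Complex.I_ne_zero key
  rw [besselJ0]
  congr 1
  have e1 : ∀ μ : ℝ, g (circleMap 0 1 μ) =
      Complex.exp (Complex.I * ρ * k * Complex.cos μ - ρ * a * Complex.sin μ) := fun μ => by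
    simp only [hg, circleMap, zero_add, Complex.ofReal_one, one_mul, exp_I_mul_add_exp_neg]
    congr 1
    linear_combination (ρ * a * Complex.sin μ) * Complex.I_sq
  have e2 : ∀ μ : ℝ, g (circleMap 0 l μ) =
      Complex.exp (Complex.I * (Real.sqrt (k ^ 2 - a ^ 2) * ρ : ℝ) * Real.cos μ) := fun μ => by
    have h1 := exp_I_mul_add_exp_neg μ 0 (((k + a) * l : ℝ) : ℂ)
    have h2 : ((k : ℂ) - a) * (l : ℂ)⁻¹ = (k + a) * l := by
      have : (k - a) * l⁻¹ = (k + a) * l := by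
        have : (k + a) * l ^ 2 = k - a := by rw [hl2]; field_simp
        field_simp
        linarith
      exact_mod_cast this
    simp only [hg, circleMap, zero_add, mul_inv]
    rw [hsq]
    congr 1
    push_cast at h1 ⊢
    linear_combination (Complex.I * ρ / 2) * h1 +
      (Complex.I * ρ / 2) * (Complex.exp (μ * Complex.I))⁻¹ * h2
  simp only [e1, e2] at key'
  exact key'.symm

/-- The principal square root in the right half-plane. -/
lemma sqrt_add_sq_spec {p : ℂ} (hp : 0 < p.re) (ρ : ℝ) :
    let R : ℂ := ((ρ : ℂ) ^ 2 + p ^ 2) ^ (1 / 2 : ℂ)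
    R ^ 2 = ρ ^ 2 + p ^ 2 ∧ p.re ≤ R.re ∧ (ρ ≠ 0 → p.re < R.re) ∧
      |ρ| < ‖p + R‖ := by
  intro R
  have e : (1 / 2 : ℂ) = ((2 : ℕ) : ℂ)⁻¹ := by norm_num
  have hsq : R ^ 2 = ρ ^ 2 + p ^ 2 := by
    simp only [R, e]
    exact Complex.cpow_nat_inv_pow _ two_ne_zero
  have hR0 : 0 ≤ R.re := by
    simp only [R, one_div]
    rw [Complex.cpow_inv_two_re]
    positivity
  have hre := congrArg Complex.re hsq
  have him := congrArg Complex.im hsq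
  simp only [pow_two, Complex.mul_re, Complex.mul_im, Complex.add_re, Complex.add_im,
    Complex.ofReal_re, Complex.ofReal_im, mul_zero, sub_zero, zero_mul, add_zero, zero_add]
    at hre him
  have huv : R.re * R.im = p.re * p.im := by linarith
  have hle : p.re ≤ R.re := by
    -- Both `R` and `p` have the same product of real and imaginary parts. A smaller real part of
    -- `R` would force a smaller `|Im R|` through the real part of `R² = ρ² + p²`, and then a
    -- smaller product.
    by_contra! hlt
    have h1 : R.im ^ 2 < p.im ^ 2 := by nlinarith [mul_self_nonneg ρ]
    have h2 : R.re ^ 2 * R.im ^ 2 = p.re ^ 2 * p.im ^ 2 := by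
      rw [← mul_pow, ← mul_pow, huv]
    have h3 : R.re ^ 2 * R.im ^ 2 ≤ p.re ^ 2 * R.im ^ 2 := by gcongr
    have h4 : p.re ^ 2 * R.im ^ 2 < p.re ^ 2 * p.im ^ 2 := by gcongr
    linarith
  have hadd : 0 < (p + R).re := by
    rw [Complex.add_re]
    linarith
  have hadd0 : p + R ≠ 0 := fun h => by simp [h] at hadd
  refine ⟨hsq, hle, fun hρ => ?_, ?_⟩
  · refine lt_of_le_of_ne hle fun heq => hρ ?_
    rw [← heq] at hre huv
    have := mul_left_cancel₀ hp.ne' huv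
    rw [this] at hre
    nlinarith
  -- Here `(R - p)(R + p) = ρ²`, while `|R - p| < |R + p|` because the real parts of `p` and `R` are
  -- positive and their imaginary parts do not have opposite signs.
  · by_contra! hcon
    have h1 : ‖R - p‖ * ‖p + R‖ = ρ ^ 2 := by
      rw [← norm_mul, show (R - p) * (p + R) = ((ρ ^ 2 : ℝ) : ℂ) by
        push_cast
        linear_combination hsq, Complex.norm_real, Real.norm_eq_abs, abs_of_nonneg (sq_nonneg _)]
    have hqv : 0 ≤ p.im * R.im := by
      have : p.re * (p.im * R.im) = R.re * R.im ^ 2 := by linear_combination -R.im * huv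
      exact nonneg_of_mul_nonneg_right (this ▸ by positivity) hp
    have hbu : 0 < p.re * R.re := mul_pos hp (hp.trans_le hle)
    have h2 : ‖R - p‖ ^ 2 < ‖p + R‖ ^ 2 := by
      rw [← Complex.normSq_eq_norm_sq, ← Complex.normSq_eq_norm_sq, Complex.normSq_apply,
        Complex.normSq_apply]
      simp only [Complex.sub_re, Complex.sub_im, Complex.add_re, Complex.add_im]
      nlinarith
    have h3 : ‖R - p‖ < ‖p + R‖ := lt_of_pow_lt_pow_left₀ 2 (norm_nonneg _) h2
    have h4 : 0 < ‖p + R‖ := norm_pos_iff.2 hadd0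
    have h5 : ‖p + R‖ ^ 2 ≤ |ρ| ^ 2 := by gcongr
    rw [sq_abs] at h5
    nlinarith

/-- The mean over the unit circle that the Laplace integral reduces to. -/
lemma circle_mean_exp_div {p : ℂ} (hp : 0 < p.re) (ρ a : ℝ) :
    let R : ℂ := ((ρ : ℂ) ^ 2 + p ^ 2) ^ (1 / 2 : ℂ)
    1 / (2 * (Real.pi : ℂ)) * ∫ μ in (0 : ℝ)..(2 * Real.pi),
        Complex.exp (-p * a + Complex.I * ρ * a * Complex.exp (μ * Complex.I)) /
          (p - Complex.I * ρ * Complex.cos μ)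
      = Complex.exp (-a * R) / R := by
  intro R
  obtain ⟨hsq, hle, -, hlt⟩ := sqrt_add_sq_spec hp ρ
  change R ^ 2 = _ at hsq
  change _ ≤ R.re at hle
  change |ρ| < ‖p + R‖ at hlt
  have hR0 : R ≠ 0 := fun h => by
    rw [h, Complex.zero_re] at hle
    linarith
  have hadd0 : p + R ≠ 0 := norm_pos_iff.1 ((abs_nonneg _).trans_lt hlt)
  -- With `ζ = e^{iμ}`, the product `ζ (p - iρ cos μ)` factors as `(ζ - w)((p + R)/2 - iρζ/2)`. Only
  -- the zero `w` lies in the closed disc, so Cauchy's formula evaluates the mean as `G w`.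
  set w : ℂ := Complex.I * ρ / (p + R) with hw
  have hw1 : w ∈ Metric.ball (0 : ℂ) 1 := by
    rw [mem_ball_zero_iff, hw, norm_div, norm_mul, Complex.norm_I, one_mul, Complex.norm_real,
      Real.norm_eq_abs]
    exact (div_lt_one ((abs_nonneg _).trans_lt hlt)).2 hlt
  set G : ℂ → ℂ := fun ζ =>
    Complex.exp (-p * a + Complex.I * ρ * a * ζ) / ((p + R) / 2 - Complex.I * ρ * ζ / 2) with hG
  have hden : ∀ ζ : ℂ, ‖ζ‖ ≤ 1 → (p + R) / 2 - Complex.I * ρ * ζ / 2 ≠ 0 := fun ζ hζ h => by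
    have h1 : p + R = Complex.I * ρ * ζ := by linear_combination 2 * h
    have h2 : ‖p + R‖ ≤ |ρ| := by
      rw [h1, norm_mul, norm_mul, Complex.norm_I, one_mul, Complex.norm_real, Real.norm_eq_abs]
      exact mul_le_of_le_one_right (abs_nonneg _) hζ
    linarith
  have hGd : DiffContOnCl ℂ G (Metric.ball 0 1) := by
    refine DifferentiableOn.diffContOnCl fun ζ hζ => ?_
    rw [closure_ball _ one_ne_zero, mem_closedBall_zero_iff] at hζ
    have h1 : DifferentiableAt ℂ
        (fun ζ : ℂ => Complex.exp (-p * a + Complex.I * ρ * a * ζ)) ζ := by fun_prop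
    have h2 : DifferentiableAt ℂ (fun ζ : ℂ => (p + R) / 2 - Complex.I * ρ * ζ / 2) ζ := by
      fun_prop
    exact (h1.fun_div h2 (hden ζ hζ)).differentiableWithinAt
  have key := hGd.circleIntegral_sub_inv_smul hw1
  -- Both identities follow from `ρ² = (R - p)(R + p)`, which gives `iρw = p - R`.
  have hGw : G w = Complex.exp (-a * R) / R := by
    simp only [hG]
    congr 1
    · congr 1
      rw [hw]
      field_simp
      rw [Complex.I_sq]
      linear_combination (a : ℂ) * hsq
    · rw [hw]
      field_simp
      rw [Complex.I_sq]
      linear_combination -hsq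
  have hpi : (Real.pi : ℂ) ≠ 0 := by exact_mod_cast Real.pi_ne_zero
  rw [hGw, circleIntegral, smul_eq_mul] at key
  have e : ∀ μ : ℝ, deriv (circleMap 0 1) μ • ((circleMap 0 1 μ - w)⁻¹ • G (circleMap 0 1 μ))
      = Complex.I * (Complex.exp (-p * a + Complex.I * ρ * a * Complex.exp (μ * Complex.I)) /
          (p - Complex.I * ρ * Complex.cos μ)) := fun μ => by
    have hn : ‖Complex.exp (μ * Complex.I)‖ = 1 := Complex.norm_exp_ofReal_mul_I μ
    have hc : circleMap 0 1 μ = Complex.exp (μ * Complex.I) := by simp [circleMap]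
    rw [deriv_circleMap, hc]
    simp only [hG, smul_eq_mul]
    have hcos := exp_I_mul_add_exp_neg μ 0 1
    simp only [add_zero, one_mul, sub_zero, mul_zero, zero_mul] at hcos
    set ζ := Complex.exp (μ * Complex.I)
    have hζ0 : ζ ≠ 0 := norm_pos_iff.1 (hn ▸ one_pos)
    have hfac : ζ * (p - Complex.I * ρ * Complex.cos μ)
        = (ζ - w) * ((p + R) / 2 - Complex.I * ρ * ζ / 2) := by
      have : Complex.cos μ = (ζ + ζ⁻¹) / 2 := by linear_combination -hcos / 2
      rw [this, hw]
      field_simp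
      linear_combination -ζ * hsq - ζ * ρ ^ 2 * Complex.I_sq
    have hζw : ζ - w ≠ 0 := by
      refine sub_ne_zero.2 fun h => ?_
      rw [mem_ball_zero_iff, ← h, hn] at hw1
      exact lt_irrefl _ hw1
    have h1 := hden ζ hn.le
    have h2 : p - Complex.I * ρ * Complex.cos μ ≠ 0 := fun h => by
      rw [h, mul_zero] at hfac
      exact mul_ne_zero hζw h1 hfac.symm
    set D := (p + R) / 2 - Complex.I * ρ * ζ / 2
    set Q := p - Complex.I * ρ * Complex.cos μ
    field_simp
    linear_combination hfac
  simp only [e] at key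
  rw [intervalIntegral.integral_const_mul] at key
  have := mul_left_cancel₀ Complex.I_ne_zero (key.trans (by ring :
    _ = Complex.I * (2 * Real.pi * (Complex.exp (-a * R) / R))))
  rw [this]
  field_simp

/-- The Laplace integral of a cylindrical wave. -/
theorem integral_laplace_besselJ0 {p : ℂ} (hp : 0 < p.re) {ρ a : ℝ} (hρ : 0 ≤ ρ) (ha : 0 ≤ a) :
    let R : ℂ := ((ρ : ℂ) ^ 2 + p ^ 2) ^ (1 / 2 : ℂ)
    ∫ k in Ioi a, Complex.exp (-p * k) * besselJ0 (Real.sqrt (k ^ 2 - a ^ 2) * ρ)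
      = Complex.exp (-a * R) / R := by
  intro R
  rw [← circle_mean_exp_div hp ρ a]
  have hpi := Real.pi_pos
  set W : ℝ → ℝ → ℂ := fun k μ => Complex.exp (-p * k) *
    Complex.exp (Complex.I * ρ * k * Complex.cos μ - ρ * a * Complex.sin μ) with hW
  have h1 : ∀ k ∈ Ioi a, Complex.exp (-p * k) * besselJ0 (Real.sqrt (k ^ 2 - a ^ 2) * ρ)
      = 1 / (2 * (Real.pi : ℂ)) * ∫ μ in Ioc (0 : ℝ) (2 * Real.pi), W k μ := fun k hk => by
    rw [besselJ0_sqrt_sub ha hk, intervalIntegral.integral_of_le (by positivity), mul_left_comm,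
      ← integral_const_mul]
  rw [setIntegral_congr_fun measurableSet_Ioi h1, integral_const_mul,
    intervalIntegral.integral_of_le (by positivity)]
  congr 1
  -- The term `iρk cos μ` is imaginary, so the circle integrand is bounded by `e^{ρa}` uniformly in
  -- `k`, and the decay of `e^{-pk}` suffices for Fubini.
  have hint : Integrable (Function.uncurry W)
      ((volume.restrict (Ioi a)).prod (volume.restrict (Ioc (0 : ℝ) (2 * Real.pi)))) := by
    have h := integrableOn_exp_mul_complex_Ioi (a := -p) (by simpa using hp) a
    have h2 : Integrable (fun _ : ℝ => Real.exp (ρ * a))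
        (volume.restrict (Ioc (0 : ℝ) (2 * Real.pi))) := integrable_const _
    refine Integrable.mono (h.norm.mul_prod h2) ?_ (Eventually.of_forall fun q => ?_)
    · refine Continuous.aestronglyMeasurable ?_
      simp only [hW, Function.uncurry_def]
      fun_prop
    · simp only [hW, Function.uncurry_def, norm_mul, norm_norm]
      gcongr
      rw [Complex.norm_exp, Real.norm_eq_abs, Real.abs_exp, Real.exp_le_exp,
        ← Complex.ofReal_cos, ← Complex.ofReal_sin]
      simp only [Complex.sub_re, Complex.mul_re, Complex.mul_im, Complex.I_re, Complex.I_im,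
        Complex.ofReal_re, Complex.ofReal_im]
      have := Real.neg_one_le_sin q.2
      nlinarith [mul_nonneg hρ ha]
  rw [integral_integral_swap hint]
  refine setIntegral_congr_fun measurableSet_Ioc fun μ _ => ?_
  have hre : (-(p - Complex.I * ρ * Complex.cos μ)).re < 0 := by
    rw [← Complex.ofReal_cos]
    simpa using hp
  have h3 : ∀ k : ℝ, W k μ = Complex.exp (-(ρ * a * Complex.sin μ)) *
      Complex.exp (-(p - Complex.I * ρ * Complex.cos μ) * k) := fun k => by
    simp only [hW, ← Complex.exp_add]
    congr 1
    ring
  simp only [h3]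
  rw [integral_const_mul, integral_exp_mul_complex_Ioi hre, neg_div_neg_eq, mul_div_assoc',
    ← Complex.exp_add]
  congr 2
  rw [Complex.exp_mul_I]
  linear_combination (-(ρ : ℂ) * a * Complex.sin μ) * Complex.I_sq

/-! ### Fubini's theorem on a wedge -/

/-- The wedge `0 < a`, `c a < k` of pairs `(k, a)`. -/
def wedge (c : ℝ) : Set (ℝ × ℝ) := {q | 0 < q.2 ∧ c * q.2 < q.1}

lemma measurableSet_wedge (c : ℝ) : MeasurableSet (wedge c) :=
  (measurableSet_lt measurable_const measurable_snd).inter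
    (measurableSet_lt (measurable_snd.const_mul c) measurable_fst)

/-- Translation invariance makes the `k`-integral independent of `a`, as for a convolution. This
product serves as the dominating function on wedges. -/
lemma integrable_prod_comp_sub_mul {f g : ℝ → ℝ} (hf : Integrable f) (hg : Integrable g)
    (hgm : Measurable g) (c : ℝ) :
    Integrable (fun q : ℝ × ℝ => f q.2 * g (q.1 - c * q.2)) := by
  have hm : AEStronglyMeasurable (fun q : ℝ × ℝ => f q.2 * g (q.1 - c * q.2))
      (volume.prod volume) := by
    refine hf.aestronglyMeasurable.comp_snd.mul (Measurable.aestronglyMeasurable ?_)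
    exact hgm.comp (measurable_fst.sub (measurable_snd.const_mul c))
  refine (integrable_prod_iff' hm).2 ⟨Eventually.of_forall fun a =>
    (hg.comp_sub_right (c * a)).const_mul (f a), ?_⟩
  simp only [norm_mul]
  simp_rw [integral_const_mul, integral_sub_right_eq_self (fun k => ‖g k‖)]
  exact hf.norm.mul_const _

/-- Decay in the distance `k - ca` from the edge is enough, since the majorant is a sheared product
of integrable functions. The slope is `1` for the wave number and the wave speed for the frequency.
-/
lemma integrable_indicator_wedge {F : ℝ → ℂ} {W : ℝ → ℝ → ℂ} {b B c : ℝ} (hb : 0 < b)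
    (hF : IntegrableOn F (Ioi 0)) (hWm : Measurable (Function.uncurry W))
    (hW : ∀ k a : ℝ, 0 < a → c * a < k → ‖W k a‖ ≤ B * Real.exp (-b * (k - c * a))) :
    Integrable ((wedge c).indicator fun q : ℝ × ℝ => F q.2 * W q.1 q.2) := by
  set F0 : ℝ → ℂ := (Ioi 0).indicator F with hF0
  set E : ℝ → ℝ := (Ioi 0).indicator fun s => Real.exp (-b * s) with hE
  have hF0i : Integrable F0 := hF.integrable_indicator measurableSet_Ioi
  have hEi : Integrable E :=
    (integrableOn_exp_mul_Ioi (neg_lt_zero.2 hb) 0).integrable_indicator measurableSet_Ioi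
  have hEm : Measurable E := Measurable.indicator (by fun_prop) measurableSet_Ioi
  have hD := (integrable_prod_comp_sub_mul hF0i.norm hEi hEm c).const_mul B
  refine hD.mono' ?_ (Eventually.of_forall fun q => ?_)
  · have : (wedge c).indicator (fun q : ℝ × ℝ => F q.2 * W q.1 q.2)
        = (wedge c).indicator fun q : ℝ × ℝ => F0 q.2 * W q.1 q.2 := by
      refine indicator_congr fun q hq => ?_
      rw [hF0, indicator_of_mem (show q.2 ∈ Ioi (0 : ℝ) from hq.1)]
    rw [this]
    refine AEStronglyMeasurable.indicator ?_ (measurableSet_wedge c)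
    exact hF0i.aestronglyMeasurable.comp_snd.mul hWm.aestronglyMeasurable
  · by_cases hq : q ∈ wedge c
    · rw [indicator_of_mem hq, hF0, hE, indicator_of_mem (show q.2 ∈ Ioi (0 : ℝ) from hq.1),
        indicator_of_mem (show q.1 - c * q.2 ∈ Ioi (0 : ℝ) from sub_pos.2 hq.2), norm_mul,
        mul_left_comm]
      exact mul_le_mul_of_nonneg_left (hW _ _ hq.1 hq.2) (norm_nonneg _)
    · rw [indicator_of_notMem hq, norm_zero]
      by_cases h0 : 0 < q.2
      · rw [hE, indicator_of_notMem, mul_zero, mul_zero]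
        exact fun h => hq ⟨h0, sub_pos.1 h⟩
      · rw [hF0, indicator_of_notMem (show q.2 ∉ Ioi (0 : ℝ) from h0), norm_zero, zero_mul,
          mul_zero]

lemma integral_indicator_wedge_left {c : ℝ} (hc : 0 < c) (f : ℝ → ℝ → ℂ) (k : ℝ) :
    ∫ a, (wedge c).indicator (fun q : ℝ × ℝ => f q.1 q.2) (k, a)
      = (Ioi 0).indicator (fun k => ∫ a in (0 : ℝ)..(k / c), f k a) k := by
  have h : ∀ a, (wedge c).indicator (fun q : ℝ × ℝ => f q.1 q.2) (k, a)
      = (Ioo 0 (k / c)).indicator (f k) a := fun a => by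
    have : (k, a) ∈ wedge c ↔ a ∈ Ioo 0 (k / c) := by
      simp only [wedge, mem_ofPred_eq, mem_Ioo, lt_div_iff₀ hc, mul_comm]
    by_cases h : a ∈ Ioo 0 (k / c)
    · rw [indicator_of_mem h, indicator_of_mem (this.2 h)]
    · rw [indicator_of_notMem h, indicator_of_notMem (fun h' => h (this.1 h'))]
  simp only [h]
  rw [integral_indicator measurableSet_Ioo]
  by_cases hk : 0 < k
  · rw [indicator_of_mem (show k ∈ Ioi (0 : ℝ) from hk),
      intervalIntegral.integral_of_le (by positivity), integral_Ioc_eq_integral_Ioo]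
  · rw [indicator_of_notMem (show k ∉ Ioi (0 : ℝ) from hk), Ioo_eq_empty, setIntegral_empty]
    rw [not_lt]
    exact div_nonpos_of_nonpos_of_nonneg (not_lt.1 hk) hc.le

lemma integral_indicator_wedge_right (F : ℝ → ℂ) (W : ℝ → ℝ → ℂ) (c a : ℝ) :
    ∫ k, (wedge c).indicator (fun q : ℝ × ℝ => F q.2 * W q.1 q.2) (k, a)
      = (Ioi 0).indicator (fun a => F a * ∫ k in Ioi (c * a), W k a) a := by
  by_cases ha : 0 < a
  · have h : ∀ k, (wedge c).indicator (fun q : ℝ × ℝ => F q.2 * W q.1 q.2) (k, a)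
        = (Ioi (c * a)).indicator (fun k => F a * W k a) k := fun k => by
      have : (k, a) ∈ wedge c ↔ k ∈ Ioi (c * a) := by
        simp [wedge, ha]
      by_cases h : k ∈ Ioi (c * a)
      · rw [indicator_of_mem h, indicator_of_mem (this.2 h)]
      · rw [indicator_of_notMem h, indicator_of_notMem (fun h' => h (this.1 h'))]
    simp only [h]
    rw [integral_indicator measurableSet_Ioi, integral_const_mul,
      indicator_of_mem (show a ∈ Ioi (0 : ℝ) from ha)]
  · have h : ∀ k, (wedge c).indicator (fun q : ℝ × ℝ => F q.2 * W q.1 q.2) (k, a) = 0 :=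
      fun k => indicator_of_notMem (fun hk => ha hk.1) _
    simp [h, ha]

section

variable {F : ℝ → ℂ} {W : ℝ → ℝ → ℂ} {b B c : ℝ}

lemma integrableOn_integral_wedge (hc : 0 < c) (hb : 0 < b)
    (hF : IntegrableOn F (Ioi 0)) (hWm : Measurable (Function.uncurry W))
    (hW : ∀ k a : ℝ, 0 < a → c * a < k → ‖W k a‖ ≤ B * Real.exp (-b * (k - c * a))) :
    IntegrableOn (fun k => ∫ a in (0 : ℝ)..(k / c), F a * W k a) (Ioi 0) := by
  have h := (integrable_indicator_wedge hb hF hWm hW).integral_prod_left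
  simp only [integral_indicator_wedge_left hc (fun k a => F a * W k a)] at h
  exact (integrable_indicator_iff measurableSet_Ioi).1 h

lemma integral_integral_wedge (hc : 0 < c) (hb : 0 < b)
    (hF : IntegrableOn F (Ioi 0)) (hWm : Measurable (Function.uncurry W))
    (hW : ∀ k a : ℝ, 0 < a → c * a < k → ‖W k a‖ ≤ B * Real.exp (-b * (k - c * a))) :
    ∫ k in Ioi (0 : ℝ), ∫ a in (0 : ℝ)..(k / c), F a * W k a
      = ∫ a in Ioi (0 : ℝ), F a * ∫ k in Ioi (c * a), W k a := by
  have h := integral_integral_swap (f := fun k a =>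
    (wedge c).indicator (fun q : ℝ × ℝ => F q.2 * W q.1 q.2) (k, a))
    (integrable_indicator_wedge hb hF hWm hW)
  simp only [integral_indicator_wedge_left hc (fun k a => F a * W k a),
    integral_indicator_wedge_right] at h
  rwa [integral_indicator measurableSet_Ioi, integral_indicator measurableSet_Ioi] at h

end

/-! ### Decay of exponentially weighted means -/

/-- Dominated convergence: the weight is at most `1` for `a ≤ K` and vanishes in the limit at each
fixed `a`. -/
lemma tendsto_integral_mul_exp_sub {g : ℝ → ℝ} {b : ℝ} (hb : 0 < b)
    (hg : IntegrableOn g (Ioi 0)) :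
    Tendsto (fun K : ℝ => ∫ a in Ioc 0 K, g a * Real.exp (-b * (K - a))) atTop (𝓝 0) := by
  have h : Tendsto (fun K : ℝ => ∫ a in Ioi (0 : ℝ),
      (Iic K).indicator (fun a => g a * Real.exp (-b * (K - a))) a) atTop
      (𝓝 (∫ _ in Ioi (0 : ℝ), (0 : ℝ))) := by
    refine tendsto_integral_filter_of_dominated_convergence (fun a => ‖g a‖)
      (Eventually.of_forall fun K => ?_) (Eventually.of_forall fun K =>
        Eventually.of_forall fun a => ?_) hg.norm (Eventually.of_forall fun a => ?_)
    · refine AEStronglyMeasurable.indicator ?_ measurableSet_Iic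
      exact hg.aestronglyMeasurable.mul (Continuous.aestronglyMeasurable (by fun_prop))
    · by_cases ha : a ≤ K
      · rw [indicator_of_mem (show a ∈ Iic K from ha), norm_mul]
        refine mul_le_of_le_one_right (norm_nonneg _) ?_
        rw [Real.norm_eq_abs, Real.abs_exp, Real.exp_le_one_iff]
        nlinarith
      · rw [indicator_of_notMem (show a ∉ Iic K from ha), norm_zero]
        exact norm_nonneg _
    · have h1 : Tendsto (fun K : ℝ => g a * Real.exp (-b * (K - a))) atTop (𝓝 (g a * 0)) := by
        refine (Real.tendsto_exp_atBot.comp ?_).const_mul _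
        exact (tendsto_atTop_add_const_right atTop (-a) tendsto_id).const_mul_atTop_of_neg
          (neg_lt_zero.2 hb)
      rw [mul_zero] at h1
      refine h1.congr' ?_
      filter_upwards [eventually_ge_atTop a] with K hK
      rw [indicator_of_mem (show a ∈ Iic K from hK)]
  rw [integral_zero] at h
  refine h.congr fun K => ?_
  rw [setIntegral_indicator measurableSet_Iic, Ioi_inter_Iic]

lemma integral_Ioc_exp_sub_le {b : ℝ} (hb : 0 < b) {K : ℝ} (hK : 0 ≤ K) :
    ∫ a in Ioc 0 K, Real.exp (-b * (K - a)) ≤ 1 / b := by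
  have h : ∀ a ∈ uIcc 0 K, HasDerivAt (fun a => Real.exp (-b * (K - a)) / b)
      (Real.exp (-b * (K - a))) a := fun a _ => by
    have h1 : HasDerivAt (fun a => -b * (K - a)) b a := by
      simpa using ((hasDerivAt_id a).const_sub K).const_mul (-b)
    have := h1.exp.div_const b
    rwa [mul_div_cancel_right₀ _ hb.ne'] at this
  rw [← intervalIntegral.integral_of_le hK, intervalIntegral.integral_eq_sub_of_hasDerivAt h
    (Continuous.intervalIntegrable (by fun_prop) _ _)]
  simp only [sub_self, mul_zero, Real.exp_zero]
  have : 0 ≤ Real.exp (-b * (K - 0)) / b := by positivity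
  linarith

/-- For `r > ε` write `r = r^{1-p} r^p` and use `1 - p ≤ 0`. This splits an `L^p` function into a
small bounded part and an integrable part. -/
lemma norm_le_add_rpow {r ε p : ℝ} (hr : 0 ≤ r) (hε : 0 < ε) (hp : 1 ≤ p) :
    r ≤ ε + ε ^ (1 - p) * r ^ p := by
  by_cases h : r ≤ ε
  · have : 0 ≤ ε ^ (1 - p) * r ^ p := by positivity
    linarith
  · push Not at h
    have h0 : 0 < r := hε.trans h
    have h1 : r ^ (1 - p) ≤ ε ^ (1 - p) :=
      Real.rpow_le_rpow_of_nonpos hε h.le (by linarith)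
    have h2 : r ^ (1 - p) * r ^ p = r := by
      rw [← Real.rpow_add h0]
      simp
    have h3 : r ^ (1 - p) * r ^ p ≤ ε ^ (1 - p) * r ^ p := by gcongr
    linarith

lemma integrableOn_norm_rpow {F : ℝ → ℂ} {p : ℝ≥0∞} (hp : 1 ≤ p) (hp' : p ≠ ⊤)
    (hF : MemLp F p (volume.restrict (Ioi 0))) :
    1 ≤ p.toReal ∧ IntegrableOn (fun a => ‖F a‖ ^ p.toReal) (Ioi 0) :=
  ⟨by simpa using ENNReal.toReal_mono hp' hp,
    hF.integrable_norm_rpow (zero_lt_one.trans_le hp).ne' hp'⟩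

/-- The bounded part of the splitting contributes at most `ε/b`, and the integrable part is
negligible for large `K`. A constant `F` shows that `p = ∞` must be excluded. -/
lemma tendsto_integral_norm_mul_exp_sub {F : ℝ → ℂ} {p : ℝ≥0∞} (hp : 1 ≤ p) (hp' : p ≠ ⊤)
    (hF : MemLp F p (volume.restrict (Ioi 0))) {b : ℝ} (hb : 0 < b) :
    Tendsto (fun K : ℝ => ∫ a in Ioc 0 K, ‖F a‖ * Real.exp (-b * (K - a))) atTop (𝓝 0) := by
  obtain ⟨hp1, hint⟩ := integrableOn_norm_rpow hp hp' hF
  set q := p.toReal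
  rw [tendsto_order]
  refine ⟨fun x hx => Eventually.of_forall fun K => hx.trans_le
    (integral_nonneg fun a => by positivity), fun x hx => ?_⟩
  -- Chosen so that `ε / b` is half of the tolerance `x`.
  set ε := x * b / 2 with hε
  have hε0 : 0 < ε := by positivity
  have ht := tendsto_integral_mul_exp_sub hb (hint.const_mul (ε ^ (1 - q)))
  filter_upwards [ht.eventually_lt_const (half_pos hx), eventually_gt_atTop 0] with K hK hK0
  have hI : ∀ {g : ℝ → ℝ}, IntegrableOn g (Ioc 0 K) →
      IntegrableOn (fun a => g a * Real.exp (-b * (K - a))) (Ioc 0 K) := fun hg =>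
    hg.mul_continuousOn_of_subset (K := Icc 0 K) (by fun_prop) measurableSet_Ioc isCompact_Icc
      Ioc_subset_Icc_self
  have h1 : IntegrableOn (fun _ : ℝ => ε) (Ioc 0 K) := by simp
  have h2 : IntegrableOn (fun a => ε ^ (1 - q) * ‖F a‖ ^ q) (Ioc 0 K) :=
    IntegrableOn.mono_set (hint.const_mul (ε ^ (1 - q))) Ioc_subset_Ioi_self
  calc ∫ a in Ioc 0 K, ‖F a‖ * Real.exp (-b * (K - a))
      ≤ ∫ a in Ioc 0 K, (ε * Real.exp (-b * (K - a)) +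
          ε ^ (1 - q) * ‖F a‖ ^ q * Real.exp (-b * (K - a))) := by
        refine integral_mono_of_nonneg (Eventually.of_forall fun a => by positivity)
          ((hI h1).add (hI h2)) (Eventually.of_forall fun a => ?_)
        simp only
        rw [← add_mul]
        gcongr
        exact norm_le_add_rpow (norm_nonneg _) hε0 hp1
    _ = ε * (∫ a in Ioc 0 K, Real.exp (-b * (K - a))) +
          ∫ a in Ioc 0 K, ε ^ (1 - q) * ‖F a‖ ^ q * Real.exp (-b * (K - a)) := by
        rw [integral_add (hI h1) (hI h2), integral_const_mul]
    _ < ε * (1 / b) + x / 2 := by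
        have := mul_le_mul_of_nonneg_left (integral_Ioc_exp_sub_le hb hK0.le) hε0.le
        linarith
    _ = x := by
        rw [hε]
        field_simp
        ring

/-! ### Superposition of cylindrical waves -/

/-- At `θ = i` the exponential is `e^{-κ}`, whose inverse is bounded on bounded intervals. -/
lemma IsFourierAmplitude.integrableOn_Ioc {f : ℂ → ℂ} {F : ℝ → ℂ} (h : IsFourierAmplitude f F)
    (K : ℝ) : IntegrableOn F (Ioc 0 K) := by
  have h1 : IntegrableOn (fun κ : ℝ => F κ * Complex.exp (Complex.I * κ * Complex.I)) (Ioc 0 K) :=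
    (h Complex.I (by simp)).1.mono_set Ioc_subset_Ioi_self
  have h2 := h1.mul_continuousOn_of_subset (K := Icc 0 K)
    (g' := fun κ : ℝ => Complex.exp (-(Complex.I * κ * Complex.I)))
    (by fun_prop) measurableSet_Ioc isCompact_Icc Ioc_subset_Icc_self
  refine h2.congr_fun (fun κ _ => ?_) measurableSet_Ioc
  simp only
  rw [mul_assoc, ← Complex.exp_add, add_neg_cancel, Complex.exp_zero, mul_one]

lemma IsFourierAmplitude.amplitudeFormulaAt {f : ℂ → ℂ} {F : ℝ → ℂ} (h : IsFourierAmplitude f F)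
    {θ : ℂ} (hθ : 0 < θ.im) : AmplitudeFormulaAt f F θ := by
  rw [AmplitudeFormulaAt, (h θ hθ).2]
  exact intervalIntegral_tendsto_integral_Ioi 0 (h θ hθ).1 tendsto_id

/-- The exponent `b - i c t` of the time dependence of the cylindrical waves. -/
noncomputable def waveExponent (c τ t : ℝ) : ℂ := ((c * τ : ℝ) : ℂ) - Complex.I * ((c * t : ℝ) : ℂ)

lemma waveExponent_re (c τ t : ℝ) : (waveExponent c τ t).re = c * τ := by
  simp [waveExponent]

/-- Since `waveExponent` is `-i c t_*`, its square is `-c² t_*²`. Thus `S = iR` with the root `R` of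
the Laplace integral. -/
lemma waveS_eq (c τ t x y : ℝ) :
    waveS c τ t x y
      = Complex.I * (((axialDist x y : ℂ) ^ 2 + waveExponent c τ t ^ 2) ^ (1 / 2 : ℂ)) := by
  rw [waveS]
  congr 3
  simp only [complexTime, waveExponent]
  push_cast
  linear_combination (-(c : ℂ) ^ 2 * (τ ^ 2 + t ^ 2)) * Complex.I_sq

lemma exp_time_eq (c τ t k : ℝ) :
    Complex.exp (Complex.I * k * (((c * t : ℝ) : ℂ) + Complex.I * ((c * τ : ℝ) : ℂ)))
      = Complex.exp (-waveExponent c τ t * k) := by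
  congr 1
  simp only [waveExponent]
  push_cast
  linear_combination ((k : ℂ) * c * τ) * Complex.I_sq

section

variable {c τ : ℝ}

lemma waveS_ne_zero (hc : 0 < c) (hτ : 0 < τ) (t x y : ℝ) : waveS c τ t x y ≠ 0 := by
  have hp : 0 < (waveExponent c τ t).re := by
    rw [waveExponent_re]
    positivity
  obtain ⟨-, hle, -⟩ := sqrt_add_sq_spec hp (axialDist x y)
  rw [waveS_eq]
  refine mul_ne_zero Complex.I_ne_zero fun h => ?_
  rw [h, Complex.zero_re] at hle
  linarith

/-- The imaginary part is `Re R - Re p`, and the inequality `Re p < Re R` is strict off the axis. -/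
lemma phase_im_pos (hc : 0 < c) (hτ : 0 < τ) {t x y : ℝ} (z : ℝ) (hρ : 0 < axialDist x y) :
    0 < (phase c τ t x y z).im := by
  have hp : 0 < (waveExponent c τ t).re := by
    rw [waveExponent_re]
    positivity
  obtain ⟨-, -, hlt, -⟩ := sqrt_add_sq_spec hp (axialDist x y)
  have h1 := hlt hρ.ne'
  rw [waveExponent_re] at h1
  rw [phase, waveS_eq, Complex.sub_im, Complex.sub_im, Complex.I_mul_im, Complex.I_mul_im,
    Complex.ofReal_im, Complex.ofReal_re]
  linarith

/-- The cylindrical wave `e^{ik(ct + ib)} J₀(√(k² - a²) ρ) e^{-ia(z + ib)}`. -/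
noncomputable def cylWave (c τ ρ z t k a : ℝ) : ℂ :=
  Complex.exp (-waveExponent c τ t * k) * besselJ0 (Real.sqrt (k ^ 2 - a ^ 2) * ρ) *
    Complex.exp (-(Complex.I * a * ((z : ℂ) + Complex.I * ((c * τ : ℝ) : ℂ))))

lemma continuous_cylWave (c τ ρ z t : ℝ) :
    Continuous (Function.uncurry (cylWave c τ ρ z t)) := by
  have := continuous_besselJ0
  simp only [cylWave, Function.uncurry_def]
  fun_prop

/-- The growth `e^{ba}` caused by the complex shift of `z` is offset by the decay `e^{-bk}`, and
`|J₀| ≤ 1`. All estimates of tails in `k` rest on this. -/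
lemma norm_cylWave_le (c τ ρ z t k a : ℝ) :
    ‖cylWave c τ ρ z t k a‖ ≤ Real.exp (-(c * τ) * (k - a)) := by
  have h1 : ‖Complex.exp (-waveExponent c τ t * k)‖ = Real.exp (-(c * τ) * k) := by
    rw [Complex.norm_exp]
    simp [waveExponent]
  have h2 : ‖Complex.exp (-(Complex.I * a * ((z : ℂ) + Complex.I * ((c * τ : ℝ) : ℂ))))‖
      = Real.exp (c * τ * a) := by
    rw [Complex.norm_exp]
    congr 1
    simp
    ring
  rw [cylWave, norm_mul, norm_mul, h1, h2]
  calc _ ≤ Real.exp (-(c * τ) * k) * 1 * Real.exp (c * τ * a) := by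
        gcongr
        exact norm_besselJ0_le _
    _ = _ := by
        rw [mul_one, ← Real.exp_add]
        congr 1
        ring

lemma integrableOn_cylWave (hc : 0 < c) (hτ : 0 < τ) (ρ z t a K : ℝ) :
    IntegrableOn (fun k => cylWave c τ ρ z t k a) (Ioi K) := by
  have h := (integrableOn_exp_mul_Ioi (neg_lt_zero.2 (mul_pos hc hτ)) K).mul_const
    (Real.exp (c * τ * a))
  refine h.mono' ?_ (Eventually.of_forall fun k => (norm_cylWave_le c τ ρ z t k a).trans_eq ?_)
  · exact ((continuous_cylWave c τ ρ z t).comp (by fun_prop : Continuous fun k : ℝ => (k, a))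
      ).aestronglyMeasurable
  · rw [← Real.exp_add]
    congr 1
    ring

lemma norm_integral_cylWave_le (hc : 0 < c) (hτ : 0 < τ) (ρ z t a K : ℝ) :
    ‖∫ k in Ioi K, cylWave c τ ρ z t k a‖ ≤ 1 / (c * τ) * Real.exp (-(c * τ) * (K - a)) := by
  have hb : 0 < c * τ := mul_pos hc hτ
  have h := (integrableOn_exp_mul_Ioi (neg_lt_zero.2 hb) K).mul_const (Real.exp (c * τ * a))
  have e : ∀ k, Real.exp (-(c * τ) * (k - a))
      = Real.exp (-(c * τ) * k) * Real.exp (c * τ * a) := fun k => by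
    rw [← Real.exp_add]
    congr 1
    ring
  refine (norm_integral_le_of_norm_le h (Eventually.of_forall fun k =>
    (norm_cylWave_le c τ ρ z t k a).trans_eq (e k))).trans_eq ?_
  rw [integral_mul_const, integral_exp_mul_Ioi (neg_lt_zero.2 hb), e, neg_div_neg_eq]
  ring

/-- In the Laplace integral `R = -iS`, so `e^{-aR}` is `e^{iaS}`, and the factor `e^{-ia(z+ib)}`
completes `S` to the phase. -/
lemma integral_cylWave (hc : 0 < c) (hτ : 0 < τ) (x y z t : ℝ) {a : ℝ} (ha : 0 ≤ a) :
    ∫ k in Ioi a, cylWave c τ (axialDist x y) z t k a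
      = Complex.I * (Complex.exp (Complex.I * a * phase c τ t x y z) / waveS c τ t x y) := by
  have hp : 0 < (waveExponent c τ t).re := by
    rw [waveExponent_re]
    positivity
  have hS := waveS_ne_zero hc hτ t x y
  simp only [cylWave]
  rw [integral_mul_const, integral_laplace_besselJ0 hp (ρ := axialDist x y) (Real.sqrt_nonneg _) ha,
    phase]
  rw [waveS_eq] at hS ⊢
  set R : ℂ := ((axialDist x y : ℂ) ^ 2 + waveExponent c τ t ^ 2) ^ (1 / 2 : ℂ)
  have hR : R ≠ 0 := fun h => hS (by rw [h, mul_zero])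
  rw [div_mul_eq_mul_div, ← Complex.exp_add]
  field_simp
  congr 1
  linear_combination (-(a : ℂ) * R) * Complex.I_sq

lemma cylOuter_eq (c τ : ℝ) (F : ℝ → ℂ) (ρ z t k : ℝ) :
    cylOuter c τ F ρ z t k = ∫ a in (0 : ℝ)..k, F a * cylWave c τ ρ z t k a := by
  rw [cylOuter, exp_time_eq, ← intervalIntegral.integral_const_mul]
  refine intervalIntegral.integral_congr fun a _ => ?_
  simp only [cylInner, cylWave]
  ring

/-- Cutting both the amplitude and the wave off at `K` reduces the wedge to the triangle `0 < a < k
≤ K`, so that integrability of `F` on `(0, K]` is all that Fubini needs. -/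
lemma integral_cylOuter (hc : 0 < c) (hτ : 0 < τ) {F : ℝ → ℂ} (ρ z t : ℝ) {K : ℝ} (hK : 0 < K)
    (hF : IntegrableOn F (Ioc 0 K)) :
    IntervalIntegrable (cylOuter c τ F ρ z t) volume 0 K ∧
      ∫ k in (0 : ℝ)..K, cylOuter c τ F ρ z t k
        = ∫ a in Ioc 0 K, F a * ∫ k in Ioc a K, cylWave c τ ρ z t k a := by
  have hb : 0 < c * τ := mul_pos hc hτ
  set F' : ℝ → ℂ := (Iic K).indicator F with hF'
  set W : ℝ → ℝ → ℂ := fun k a => (Iic K).indicator (fun k => cylWave c τ ρ z t k a) k with hW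
  have hF'i : IntegrableOn F' (Ioi 0) := by
    rw [hF', IntegrableOn, integrable_indicator_iff measurableSet_Iic, IntegrableOn,
      Measure.restrict_restrict measurableSet_Iic, Iic_inter_Ioi]
    exact hF
  have hWm : Measurable (Function.uncurry W) := by
    have : Function.uncurry W = {q : ℝ × ℝ | q.1 ≤ K}.indicator
        (Function.uncurry (cylWave c τ ρ z t)) := by
      ext q
      by_cases hq : q.1 ≤ K <;> simp [hW, Function.uncurry_def, indicator, hq]
    rw [this]
    exact (continuous_cylWave c τ ρ z t).measurable.indicator
      (measurableSet_le measurable_fst measurable_const)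
  have hWb : ∀ k a : ℝ, 0 < a → 1 * a < k →
      ‖W k a‖ ≤ 1 * Real.exp (-(c * τ) * (k - 1 * a)) := fun k a _ _ => by
    rw [one_mul, one_mul]
    exact (norm_indicator_le_norm_self _ _).trans (norm_cylWave_le c τ ρ z t k a)
  have hin : ∀ k, ∫ a in (0 : ℝ)..(k / 1), F' a * W k a
      = (Iic K).indicator (cylOuter c τ F ρ z t) k := fun k => by
    rw [div_one]
    by_cases hk : k ≤ K
    · rw [indicator_of_mem (show k ∈ Iic K from hk), cylOuter_eq]
      refine intervalIntegral.integral_congr fun a ha => ?_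
      have ha' : a ∈ Iic K := ha.2.trans (max_le hK.le hk)
      simp only [hF', hW, indicator_of_mem ha', indicator_of_mem (show k ∈ Iic K from hk)]
    · rw [indicator_of_notMem (show k ∉ Iic K from hk)]
      simp [hW, indicator_of_notMem (show k ∉ Iic K from hk)]
  have h1 := integrableOn_integral_wedge one_pos hb hF'i hWm hWb
  have h2 := integral_integral_wedge one_pos hb hF'i hWm hWb
  simp only [hin] at h1 h2
  rw [IntegrableOn, integrable_indicator_iff measurableSet_Iic, IntegrableOn,
    Measure.restrict_restrict measurableSet_Iic, Iic_inter_Ioi] at h1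
  refine ⟨(intervalIntegrable_iff_integrableOn_Ioc_of_le hK.le).2 h1, ?_⟩
  rw [intervalIntegral.integral_of_le hK.le, ← Ioi_inter_Iic, ← setIntegral_indicator
    measurableSet_Iic, h2, ← setIntegral_indicator measurableSet_Iic]
  refine setIntegral_congr_fun measurableSet_Ioi fun a _ => ?_
  simp only [one_mul, hF', hW]
  by_cases ha : a ≤ K
  · rw [indicator_of_mem (show a ∈ Iic K from ha), indicator_of_mem (show a ∈ Iic K from ha),
      setIntegral_indicator measurableSet_Iic, Ioi_inter_Iic]
  · rw [indicator_of_notMem (show a ∉ Iic K from ha), indicator_of_notMem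
      (show a ∉ Iic K from ha), zero_mul]

lemma intervalIntegrable_cylInner {F : ℝ → ℂ} (ρ z : ℝ) {k : ℝ} (hk : 0 < k)
    (hF : IntegrableOn F (Ioc 0 k)) : IntervalIntegrable (cylInner c τ F ρ z k) volume 0 k := by
  have hF' := (intervalIntegrable_iff_integrableOn_Ioc_of_le hk.le).2 hF
  have := continuous_besselJ0
  have h := hF'.mul_continuousOn (g := fun a : ℝ => besselJ0 (Real.sqrt (k ^ 2 - a ^ 2) * ρ) *
    Complex.exp (-(Complex.I * a * ((z : ℂ) + Complex.I * ((c * τ : ℝ) : ℂ)))))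
    (Continuous.continuousOn (by fun_prop))
  refine h.congr fun a _ => ?_
  simp only [cylInner]
  ring

/-- The representation by cylindrical waves, for amplitudes with decaying exponential means. -/
theorem hasCylindrical_of_tendsto (hc : 0 < c) (hτ : 0 < τ) {f : ℂ → ℂ} {F : ℝ → ℂ}
    (hF : ∀ K, IntegrableOn F (Ioc 0 K))
    (hdecay : Tendsto (fun K : ℝ => ∫ a in Ioc 0 K, ‖F a‖ * Real.exp (-(c * τ) * (K - a)))
      atTop (𝓝 0)) (t x y z : ℝ) (hA : AmplitudeFormulaAt f F (phase c τ t x y z)) :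
    HasCylindrical c τ F (axialDist x y) z t (quasiSpherical c τ f t x y z) := by
  refine ⟨fun k hk => intervalIntegrable_cylInner _ _ hk (hF k), fun K hK =>
    (integral_cylOuter hc hτ _ _ _ hK (hF K)).1, ?_⟩
  have hb : 0 < c * τ := mul_pos hc hτ
  set θ := phase c τ t x y z with hθ
  set S := waveS c τ t x y
  -- The region `a ≤ K < k` is what the triangle lacks of the full integrals over `k > a`.
  set err : ℝ → ℂ := fun K => ∫ a in Ioc 0 K,
    F a * ∫ k in Ioi K, cylWave c τ (axialDist x y) z t k a with herr
  have herr0 : Tendsto err atTop (𝓝 0) := by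
    refine squeeze_zero_norm (fun K => ?_) (a := fun K =>
      1 / (c * τ) * ∫ a in Ioc 0 K, ‖F a‖ * Real.exp (-(c * τ) * (K - a))) ?_
    · rw [← integral_const_mul]
      refine norm_integral_le_of_norm_le ?_ (Eventually.of_forall fun a => ?_)
      · refine Integrable.const_mul ?_ _
        exact IntegrableOn.mul_continuousOn_of_subset (K := Icc 0 K) (hF K).norm (by fun_prop)
          measurableSet_Ioc isCompact_Icc Ioc_subset_Icc_self
      · rw [norm_mul, mul_left_comm]
        exact mul_le_mul_of_nonneg_left (norm_integral_cylWave_le hc hτ _ _ _ _ _) (norm_nonneg _)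
    · simpa using hdecay.const_mul (1 / (c * τ))
  -- The truncated wave is exactly `(1/S) ∫₀^K F(a) e^{iaθ} da + i · err K`.
  have hmain := ((hA.div_const S).add (herr0.const_mul Complex.I))
  rw [mul_zero, add_zero] at hmain
  refine hmain.congr' ?_
  filter_upwards [eventually_gt_atTop 0] with K hK
  rw [(integral_cylOuter hc hτ _ _ _ hK (hF K)).2, intervalIntegral.integral_of_le hK.le,
    ← integral_div, herr]
  have hI1 : IntegrableOn (fun a : ℝ => F a * Complex.exp (Complex.I * a * θ) / S) (Ioc 0 K) :=
    Integrable.div_const (IntegrableOn.mul_continuousOn_of_subset (K := Icc 0 K) (hF K)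
      (by fun_prop) measurableSet_Ioc isCompact_Icc Ioc_subset_Icc_self) _
  have hsplit : ∀ a ∈ Ioc 0 K, F a * ∫ k in Ioc a K, cylWave c τ (axialDist x y) z t k a
      = Complex.I * (F a * Complex.exp (Complex.I * a * θ) / S)
        - F a * ∫ k in Ioi K, cylWave c τ (axialDist x y) z t k a := fun a ha => by
    have h1 := integral_cylWave hc hτ x y z t ha.1.le
    rw [← Ioc_union_Ioi_eq_Ioi ha.2, setIntegral_union (Ioc_disjoint_Ioi le_rfl)
      measurableSet_Ioi ((integrableOn_cylWave hc hτ _ _ _ a a).mono_set Ioc_subset_Ioi_self)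
      (integrableOn_cylWave hc hτ _ _ _ a K)] at h1
    rw [eq_sub_of_add_eq h1]
    ring
  have hI2 : IntegrableOn (fun a : ℝ => F a * ∫ k in Ioi K,
      cylWave c τ (axialDist x y) z t k a) (Ioc 0 K) := by
    have hm : AEStronglyMeasurable (fun a : ℝ => ∫ k in Ioi K,
        cylWave c τ (axialDist x y) z t k a) (volume.restrict (Ioc 0 K)) := by
      refine StronglyMeasurable.aestronglyMeasurable ?_
      refine StronglyMeasurable.integral_prod_right (f := fun a k =>
        cylWave c τ (axialDist x y) z t k a) ?_
      exact ((continuous_cylWave c τ (axialDist x y) z t).comp continuous_swap).stronglyMeasurable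
    refine Integrable.mul_bdd (c := 1 / (c * τ)) (hF K) hm ?_
    refine ae_restrict_of_forall_mem measurableSet_Ioc fun a ha =>
      (norm_integral_cylWave_le hc hτ _ _ _ _ _).trans ?_
    refine mul_le_of_le_one_right (by positivity) ?_
    rw [Real.exp_le_one_iff]
    nlinarith [ha.2]
  rw [setIntegral_congr_fun measurableSet_Ioc hsplit, integral_sub (hI1.const_mul _) hI2,
    integral_const_mul, mul_sub, ← mul_assoc]
  simp

/-- Under `k = ω/c`, the factor `e^{ab}` of the weight turns `z` into `z + ib`. The remaining
`e^{-(ω/c)b}` belongs to the time exponential. -/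
lemma fbInner_eq (F : ℝ → ℂ) (ρ z ω a : ℝ) :
    fbInner c (fbWeight c τ F) ρ z ω a
      = -(Complex.I / c) * Complex.exp (-((ω / c * (c * τ) : ℝ) : ℂ)) *
        cylInner c τ F ρ z (ω / c) a := by
  have h : ω ^ 2 / c ^ 2 = (ω / c) ^ 2 := by rw [div_pow]
  have h2 : (Real.exp (-(ω / c - a) * (c * τ)) : ℂ) * Complex.exp (-(Complex.I * a * z))
      = Complex.exp (-((ω / c * (c * τ) : ℝ) : ℂ)) *
        Complex.exp (-(Complex.I * a * ((z : ℂ) + Complex.I * ((c * τ : ℝ) : ℂ)))) := by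
    rw [Complex.ofReal_exp, ← Complex.exp_add, ← Complex.exp_add]
    congr 1
    push_cast
    linear_combination ((a : ℂ) * c * τ) * Complex.I_sq
  rw [fbInner, fbWeight, cylInner, h, mul_comm ρ]
  linear_combination -(Complex.I / c) * F a * besselJ0 (Real.sqrt ((ω / c) ^ 2 - a ^ 2) * ρ) * h2

lemma fbOuter_eq (hc : c ≠ 0) (F : ℝ → ℂ) (ρ z t ω : ℝ) :
    fbOuter c (fbWeight c τ F) ρ z t ω
      = -(Complex.I / c) * cylOuter c τ F ρ z t (ω / c) := by
  simp only [fbOuter, cylOuter, fbInner_eq]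
  rw [intervalIntegral.integral_const_mul]
  have h : Complex.exp (Complex.I * ω * t) * Complex.exp (-((ω / c * (c * τ) : ℝ) : ℂ))
      = Complex.exp (Complex.I * ((ω / c : ℝ) : ℂ) *
        (((c * t : ℝ) : ℂ) + Complex.I * ((c * τ : ℝ) : ℂ))) := by
    have hc' : (c : ℂ) ≠ 0 := by exact_mod_cast hc
    rw [← Complex.exp_add]
    congr 1
    push_cast
    field_simp
    linear_combination (-(ω : ℂ) * τ) * Complex.I_sq
  rw [← h]
  ring

theorem HasCylindrical.hasFourierBessel (hc : 0 < c) {F : ℝ → ℂ} {ρ z t : ℝ} {u : ℂ}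
    (h : HasCylindrical c τ F ρ z t u) : HasFourierBessel c (fbWeight c τ F) ρ z t u := by
  obtain ⟨h1, h2, h3⟩ := h
  have hc' : (c : ℂ) ≠ 0 := by exact_mod_cast hc.ne'
  refine ⟨fun ω hω => ?_, fun Ω hΩ => ?_, ?_⟩
  · rw [funext (fbInner_eq F ρ z ω)]
    exact (h1 (ω / c) (by positivity)).const_mul _
  · rw [funext (fbOuter_eq hc.ne' F ρ z t)]
    refine IntervalIntegrable.const_mul ?_ _
    have := (h2 (Ω / c) (by positivity)).comp_mul_left (c := c⁻¹) 
    simpa [div_eq_inv_mul, hc.ne'] using this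
  · refine (h3.comp (tendsto_id.atTop_div_const hc)).congr fun Ω => ?_
    simp only [fbOuter_eq hc.ne', Function.comp_apply, id]
    rw [intervalIntegral.integral_const_mul, intervalIntegral.integral_comp_div _ hc.ne', zero_div,
      Complex.real_smul]
    field_simp

/-- The integrand decays like `e^{-τ(ω - ca)}` because `b(ω/c - a) = τ(ω - ca)`, so the wedge
estimate applies with slope `c`. The value follows from uniqueness of limits. -/
theorem HasFourierBessel.hasAbsFourierBessel (hc : 0 < c) (hτ : 0 < τ) {F : ℝ → ℂ}
    (hF : IntegrableOn F (Ioi 0)) {ρ z t : ℝ} {u : ℂ}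
    (h : HasFourierBessel c (fbWeight c τ F) ρ z t u) :
    HasAbsFourierBessel c (fbWeight c τ F) ρ z t u := by
  set W : ℝ → ℝ → ℂ := fun ω a => -(Complex.I / c) * cylWave c τ ρ z t (ω / c) a with hW
  have hWm : Measurable (Function.uncurry W) := by
    refine Continuous.measurable (continuous_const.mul ?_)
    exact (continuous_cylWave c τ ρ z t).comp
      (by fun_prop : Continuous fun q : ℝ × ℝ => (q.1 / c, q.2))
  have hWb : ∀ ω a : ℝ, 0 < a → c * a < ω →
      ‖W ω a‖ ≤ 1 / c * Real.exp (-τ * (ω - c * a)) := fun ω a _ _ => by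
    rw [hW, norm_mul, norm_neg, norm_div, Complex.norm_I, Complex.norm_real, Real.norm_eq_abs,
      abs_of_pos hc]
    refine mul_le_mul_of_nonneg_left ((norm_cylWave_le _ _ _ _ _ _ _).trans_eq ?_) (by positivity)
    congr 1
    field_simp
  have hin : ∀ ω a : ℝ, Complex.exp (Complex.I * ω * t) * fbInner c (fbWeight c τ F) ρ z ω a
      = F a * W ω a := fun ω a => by
    have hc' : (c : ℂ) ≠ 0 := by exact_mod_cast hc.ne'
    have he : Complex.exp (Complex.I * ω * t) * Complex.exp (-((ω / c * (c * τ) : ℝ) : ℂ))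
        = Complex.exp (-waveExponent c τ t * (ω / c : ℝ)) := by
      rw [← Complex.exp_add]
      congr 1
      simp only [waveExponent]
      push_cast
      field_simp
      ring
    rw [fbInner_eq, hW]
    simp only [cylWave, cylInner]
    rw [← he]
    ring
  have hset : {q : ℝ × ℝ | 0 < q.1 ∧ 0 < q.2 ∧ q.2 < q.1 / c} = wedge c := by
    ext q
    simp only [wedge, mem_ofPred_eq, lt_div_iff₀ hc, mul_comm c]
    exact ⟨fun h => h.2, fun h => ⟨(mul_pos h.1 hc).trans h.2, h⟩⟩
  have hout : ∀ ω, fbOuter c (fbWeight c τ F) ρ z t ω = ∫ a in (0 : ℝ)..(ω / c), F a * W ω a :=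
    fun ω => by
      rw [fbOuter, ← intervalIntegral.integral_const_mul]
      simp only [hin]
  refine ⟨?_, ?_⟩
  · simp only [hin]
    rw [hset, ← integrable_indicator_iff (measurableSet_wedge c)]
    exact integrable_indicator_wedge hτ hF hWm hWb
  · refine tendsto_nhds_unique h.2.2 (intervalIntegral_tendsto_integral_Ioi 0 ?_ tendsto_id)
    rw [funext hout]
    exact integrableOn_integral_wedge hc hτ hF hWm hWb

end

/-! ### Amplitudes of class `L^p` -/

lemma norm_exp_I_mul (κ : ℝ) (θ : ℂ) : ‖Complex.exp (Complex.I * κ * θ)‖ = Real.exp (-κ * θ.im) := by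
  rw [Complex.norm_exp]
  simp

/-- Half of the exponential decay absorbs the factor `κ` produced by differentiation in `θ`. -/
lemma mul_exp_neg_mul_le {κ y : ℝ} (hy : 0 < y) :
    κ * Real.exp (-κ * y) ≤ 2 / y * Real.exp (-κ * (y / 2)) := by
  have h1 : κ * (y / 2) ≤ Real.exp (κ * (y / 2)) := by
    linarith [Real.add_one_le_exp (κ * (y / 2))]
  have h2 : Real.exp (-κ * y) = Real.exp (-κ * (y / 2)) * (Real.exp (κ * (y / 2)))⁻¹ := by
    rw [← Real.exp_neg, ← Real.exp_add]
    congr 1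
    ring
  have h3 : κ * (Real.exp (κ * (y / 2)))⁻¹ ≤ 2 / y := by
    rw [← div_eq_mul_inv, div_le_div_iff₀ (Real.exp_pos _) hy]
    linarith
  rw [h2, mul_left_comm, mul_comm]
  gcongr

lemma differentiableOn_integral_exp {F : ℝ → ℂ}
    (hF : ∀ θ : ℂ, 0 < θ.im →
      IntegrableOn (fun κ : ℝ => F κ * Complex.exp (Complex.I * κ * θ)) (Ioi 0)) :
    DifferentiableOn ℂ (fun θ : ℂ => ∫ κ in Ioi (0 : ℝ), F κ * Complex.exp (Complex.I * κ * θ))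
      {θ : ℂ | 0 < θ.im} := by
  intro θ hθ
  have hθ' : 0 < θ.im := hθ
  set y := θ.im / 2 with hy
  have hy0 : 0 < y := half_pos hθ'
  have hs : {η : ℂ | y < η.im} ∈ 𝓝 θ :=
    (isOpen_lt continuous_const Complex.continuous_im).mem_nhds (half_lt_self hθ')
  -- The integrand at the lower height `y/2` dominates the derivatives at all heights above `y`.
  have hb := (hF (Complex.I * ((y / 2 : ℝ) : ℂ)) (by simpa using hy0)).norm.const_mul (2 / y)
  have hm : ∀ η : ℂ, AEStronglyMeasurable (fun κ : ℝ => F κ * Complex.exp (Complex.I * κ * η))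
      (volume.restrict (Ioi 0)) := fun η => by
    have h1 := (hF Complex.I (by simp)).aestronglyMeasurable
    have h2 : AEStronglyMeasurable (fun κ : ℝ => Complex.exp (Complex.I * κ * (η - Complex.I)))
        (volume.restrict (Ioi 0)) := Continuous.aestronglyMeasurable (by fun_prop)
    refine (h1.mul h2).congr (Eventually.of_forall fun κ => ?_)
    simp only [Pi.mul_apply]
    rw [mul_assoc, ← Complex.exp_add]
    congr 2
    ring
  refine (hasDerivAt_integral_of_dominated_loc_of_deriv_le (𝕜 := ℂ) hs
    (F' := fun η κ => F κ * (Complex.exp (Complex.I * κ * η) * (Complex.I * κ)))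
    (Eventually.of_forall hm) (hF θ hθ) ?_ ?_ hb ?_).2.differentiableAt.differentiableWithinAt
  · have h2 : AEStronglyMeasurable (fun κ : ℝ => Complex.I * (κ : ℂ))
        (volume.restrict (Ioi 0)) := Continuous.aestronglyMeasurable (by fun_prop)
    refine ((hm θ).mul h2).congr (Eventually.of_forall fun κ => ?_)
    simp only [Pi.mul_apply, mul_assoc]
  · refine ae_restrict_of_forall_mem measurableSet_Ioi fun κ hκ η hη => ?_
    have hκ' : (0 : ℝ) < κ := hκ
    have hη' : y < η.im := hη
    rw [norm_mul, norm_mul, norm_mul, norm_mul, Complex.norm_I, one_mul, norm_exp_I_mul,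
      norm_exp_I_mul, Complex.norm_real, Real.norm_eq_abs, abs_of_pos hκ', mul_left_comm (2 / y)]
    refine mul_le_mul_of_nonneg_left ?_ (norm_nonneg (F κ))
    have e : (Complex.I * ((y / 2 : ℝ) : ℂ)).im = y / 2 := by simp
    rw [e]
    refine le_trans ?_ (mul_exp_neg_mul_le hy0)
    rw [mul_comm]
    refine mul_le_mul_of_nonneg_left (Real.exp_le_exp.2 ?_) hκ'.le
    nlinarith
  · refine Eventually.of_forall fun κ η _ => ?_
    have h1 : HasDerivAt (fun η : ℂ => Complex.I * κ * η) (Complex.I * κ) η := by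
      simpa using (hasDerivAt_id η).const_mul (Complex.I * (κ : ℂ))
    exact h1.cexp.const_mul (F κ)

theorem exists_isFourierAmplitude_of_memLp {p : ℝ≥0∞} {F : ℝ → ℂ} (hp : 1 ≤ p) (hp' : p ≠ ⊤)
    (hF : MemLp F p (volume.restrict (Ioi 0))) :
    ∃ f : ℂ → ℂ, DifferentiableOn ℂ f {θ : ℂ | 0 < θ.im} ∧ IsFourierAmplitude f F := by
  obtain ⟨hp1, hint⟩ := integrableOn_norm_rpow hp hp' hF
  have hI : ∀ θ : ℂ, 0 < θ.im →
      IntegrableOn (fun κ : ℝ => F κ * Complex.exp (Complex.I * κ * θ)) (Ioi 0) := fun θ hθ => by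
    have h1 := (integrableOn_exp_mul_Ioi (neg_lt_zero.2 hθ) 0).add hint
    refine h1.mono' ?_ (ae_restrict_of_forall_mem measurableSet_Ioi fun κ hκ => ?_)
    · exact hF.aestronglyMeasurable.mul (Continuous.aestronglyMeasurable (by fun_prop))
    · have hκ' : (0 : ℝ) < κ := hκ
      rw [norm_mul, norm_exp_I_mul, Pi.add_apply]
      -- With `ε = 1` the bound reads `|F| ≤ 1 + |F|^p`; the exponential is needed only for the
      -- constant.
      have h2 := norm_le_add_rpow (norm_nonneg (F κ)) one_pos hp1
      rw [Real.one_rpow, one_mul] at h2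
      have h3 : Real.exp (-κ * θ.im) ≤ 1 := Real.exp_le_one_iff.2 (by nlinarith)
      have h4 : 0 ≤ ‖F κ‖ ^ p.toReal := by positivity
      calc ‖F κ‖ * Real.exp (-κ * θ.im)
          ≤ (1 + ‖F κ‖ ^ p.toReal) * Real.exp (-κ * θ.im) := by gcongr
        _ ≤ Real.exp (-θ.im * κ) + ‖F κ‖ ^ p.toReal := by
            rw [add_mul, one_mul, show -κ * θ.im = -θ.im * κ by ring] at *
            nlinarith
  exact ⟨_, differentiableOn_integral_exp hI, fun θ hθ => ⟨hI θ hθ, rfl⟩⟩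

/-! ### Cauchy's formula in the upper half-plane -/

/-- A function that is analytic in the open upper half-plane, continuous up to the real line, and
`O(1/|z|)` at infinity. -/
structure HasHalfPlaneDecay (g : ℂ → ℂ) (C : ℝ) : Prop where
  continuousOn : ContinuousOn g {z : ℂ | 0 ≤ z.im}
  differentiableOn : DifferentiableOn ℂ g {z : ℂ | 0 < z.im}
  bound : ∀ z : ℂ, 0 ≤ z.im → ‖g z‖ ≤ C / (1 + ‖z‖)

/-- Cauchy's theorem on the rectangle `[-T, T] × [0, T]`: the three sides off the real line have
total length `4T` and carry values of size at most `C/T²`. -/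
lemma integral_real_eq_zero_of_half_plane {h : ℂ → ℂ} {C T₀ : ℝ}
    (hc : ContinuousOn h {z : ℂ | 0 ≤ z.im}) (hd : DifferentiableOn ℂ h {z : ℂ | 0 < z.im})
    (hi : Integrable fun r : ℝ => h r)
    (hb : ∀ z : ℂ, 0 ≤ z.im → T₀ ≤ ‖z‖ → ‖h z‖ ≤ C / ‖z‖ ^ 2) : ∫ r : ℝ, h r = 0 := by
  have h1 : Tendsto (fun T : ℝ => ∫ r in (-T)..T, h r) atTop (𝓝 (∫ r : ℝ, h r)) :=
    intervalIntegral_tendsto_integral hi tendsto_neg_atTop_atBot tendsto_id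
  refine tendsto_nhds_unique h1 (squeeze_zero_norm' (a := fun T : ℝ => 4 * C / T) ?_
    (tendsto_const_nhds.div_atTop tendsto_id))
  filter_upwards [eventually_gt_atTop 0, eventually_ge_atTop T₀] with T hT hT0
  have hC : ∀ z : ℂ, 0 ≤ z.im → T ≤ ‖z‖ → ‖h z‖ ≤ C / T ^ 2 := fun z hz hzT => by
    have h2 := hb z hz (hT0.trans hzT)
    have hz0 : 0 < ‖z‖ := hT.trans_le hzT
    have hC0 : 0 ≤ C := by
      by_contra! hneg
      have := h2.trans_lt (div_neg_of_neg_of_pos hneg (by positivity))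
      exact absurd (norm_nonneg _) (not_le.2 this)
    exact h2.trans (by gcongr)
  have hrect := Complex.integral_boundary_rect_eq_zero_of_continuousOn_of_differentiableOn h
    (-(T : ℂ)) ((T : ℂ) + T * Complex.I)
    (hc.mono fun z hz => by
      have := hz.2
      simp [uIcc_of_le hT.le] at this
      exact this.1)
    (hd.mono fun z hz => by
      have := hz.2
      simp [min_eq_left hT.le] at this
      exact this.1)
  simp only [Complex.neg_re, Complex.ofReal_re, Complex.add_re, Complex.mul_re, Complex.I_re,
    mul_zero, Complex.ofReal_im, Complex.I_im, mul_one, sub_zero, add_zero, Complex.neg_im,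
    neg_zero, Complex.ofReal_zero, zero_mul, Complex.add_im, Complex.mul_im, zero_add,
    smul_eq_mul] at hrect
  have htop : ‖∫ x in (-T)..T, h (x + T * Complex.I)‖ ≤ C / T ^ 2 * |T - -T| :=
    intervalIntegral.norm_integral_le_of_norm_le_const fun x _ => hC _ (by simpa using hT.le) (by
      refine le_trans ?_ (Complex.abs_im_le_norm _)
      simp [le_abs_self])
  have hside : ∀ s : ℝ, |s| = T →
      ‖∫ y in (0 : ℝ)..T, h (s + y * Complex.I)‖ ≤ C / T ^ 2 * |T - 0| := fun s hs =>
    intervalIntegral.norm_integral_le_of_norm_le_const fun y hy => by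
      rw [uIoc_of_le hT.le] at hy
      refine hC _ (by simpa using hy.1.le) ?_
      refine le_trans ?_ (Complex.abs_re_le_norm _)
      simp [hs]
  have hs1 := hside T (abs_of_pos hT)
  have hs2 := hside (-T) (by rw [abs_neg, abs_of_pos hT])
  push_cast at hs2 hrect
  rw [show (∫ r in (-T)..T, h r) = (∫ x in (-T)..T, h (x + T * Complex.I))
    - Complex.I * (∫ y in (0 : ℝ)..T, h (T + y * Complex.I))
    + Complex.I * (∫ y in (0 : ℝ)..T, h (-T + y * Complex.I)) by linear_combination hrect]
  refine (norm_add_le _ _).trans ((add_le_add_left (norm_sub_le _ _) _).trans ?_)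
  rw [norm_mul, norm_mul, Complex.norm_I, one_mul, one_mul]
  rw [sub_neg_eq_add, abs_of_pos (by positivity)] at htop
  rw [sub_zero, abs_of_pos hT] at hs1 hs2
  calc _ ≤ C / T ^ 2 * (T + T) + C / T ^ 2 * T + C / T ^ 2 * T := by gcongr
    _ = 4 * C / T := by
        field_simp
        ring

/-- A Cauchy kernel therefore has the decay `1/(1 + |z|)` at vertical distance at least `δ` from its
pole. -/
lemma one_add_norm_le_mul_norm_sub {z v : ℂ} {δ : ℝ} (hδ : 0 < δ) (h : δ ≤ |(z - v).im|) :
    1 + ‖z‖ ≤ ((1 + ‖v‖) / δ + 1) * ‖z - v‖ := by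
  have h1 : δ ≤ ‖z - v‖ := h.trans (Complex.abs_im_le_norm _)
  have h2 : ‖z‖ ≤ ‖z - v‖ + ‖v‖ := norm_le_norm_sub_add z v
  have h3 : 1 + ‖v‖ ≤ (1 + ‖v‖) / δ * ‖z - v‖ := by
    rw [div_mul_eq_mul_div, le_div_iff₀ hδ]
    gcongr
  linarith

lemma norm_inv_sub_le {z v : ℂ} {δ : ℝ} (hδ : 0 < δ) (h : δ ≤ |(z - v).im|) :
    ‖(z - v)⁻¹‖ ≤ ((1 + ‖v‖) / δ + 1) / (1 + ‖z‖) := by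
  have h1 : 0 < ‖z - v‖ := hδ.trans_le (h.trans (Complex.abs_im_le_norm _))
  rw [norm_inv, inv_eq_one_div, div_le_div_iff₀ h1 (by positivity), one_mul]
  exact one_add_norm_le_mul_norm_sub hδ h

lemma integrable_mul_of_norm_le {u v : ℝ → ℂ} {C D : ℝ} (hu : AEStronglyMeasurable u)
    (hv : AEStronglyMeasurable v) (huC : ∀ r, ‖u r‖ ≤ C / (1 + |r|))
    (hvD : ∀ r, ‖v r‖ ≤ D / (1 + |r|)) : Integrable fun r => u r * v r := by
  have hC : 0 ≤ C := by simpa using (norm_nonneg _).trans (huC 0)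
  have hD : 0 ≤ D := by simpa using (norm_nonneg _).trans (hvD 0)
  refine (integrable_inv_one_add_sq.const_mul (C * D)).mono' (hu.mul hv)
    (Eventually.of_forall fun r => ?_)
  calc ‖u r * v r‖ ≤ C / (1 + |r|) * (D / (1 + |r|)) := by
        rw [norm_mul]
        exact mul_le_mul (huC r) (hvD r) (norm_nonneg _) (by positivity)
    _ = C * D * ((1 + |r|) ^ 2)⁻¹ := by
        field_simp
    _ ≤ C * D * (1 + r ^ 2)⁻¹ := by
        gcongr
        nlinarith [abs_nonneg r, sq_abs r]

namespace HasHalfPlaneDecay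

variable {g : ℂ → ℂ} {C : ℝ}

lemma continuous_real (hg : HasHalfPlaneDecay g C) : Continuous fun r : ℝ => g r :=
  hg.continuousOn.comp_continuous Complex.continuous_ofReal fun r => by simp

lemma norm_real_le (hg : HasHalfPlaneDecay g C) (r : ℝ) : ‖g r‖ ≤ C / (1 + |r|) := by
  simpa using hg.bound r (by simp)

lemma integrable_mul_inv_sub (hg : HasHalfPlaneDecay g C) {w : ℂ} (hw : w.im ≠ 0) :
    Integrable fun r : ℝ => g r * ((r : ℂ) - w)⁻¹ := by
  have h0 : ∀ r : ℝ, (r : ℂ) - w ≠ 0 := fun r h => hw (by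
    have := congrArg Complex.im h
    simpa using this)
  refine integrable_mul_of_norm_le (D := (1 + ‖w‖) / |w.im| + 1)
    hg.continuous_real.aestronglyMeasurable
    (Continuous.aestronglyMeasurable (Continuous.inv₀ (by fun_prop) h0)) hg.norm_real_le
    fun r => ?_
  have h := norm_inv_sub_le (z := r) (v := w) (abs_pos.2 hw) (by simp)
  rwa [Complex.norm_real, Real.norm_eq_abs] at h

/-- The zero of `g` cancels the pole: the quotient is `dslope g w`, analytic in the half-plane and
`O(1/|z|²)` at infinity. -/
lemma integral_mul_inv_sub_eq_zero (hg : HasHalfPlaneDecay g C) {w : ℂ} (hw : 0 < w.im)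
    (hgw : g w = 0) : ∫ r : ℝ, g r * ((r : ℂ) - w)⁻¹ = 0 := by
  have hval : ∀ z : ℂ, z ≠ w → dslope g w z = g z * (z - w)⁻¹ := fun z hz => by
    rw [dslope_of_ne _ hz, slope_def_field, hgw, sub_zero, div_eq_mul_inv]
  have hne : ∀ r : ℝ, (r : ℂ) ≠ w := fun r h => hw.ne (by rw [← h]; simp)
  have hnh : {z : ℂ | 0 < z.im} ∈ 𝓝 w :=
    (isOpen_lt continuous_const Complex.continuous_im).mem_nhds hw
  have hnh' : {z : ℂ | 0 ≤ z.im} ∈ 𝓝 w := mem_of_superset hnh fun z (hz : 0 < z.im) => hz.le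
  have hval' : ∀ r : ℝ, dslope g w r = g r * ((r : ℂ) - w)⁻¹ := fun r => hval r (hne r)
  have hC : 0 ≤ C := by simpa using (norm_nonneg _).trans (hg.norm_real_le 0)
  simp only [← hval']
  -- Beyond this radius `|z - w| ≥ |z|/2` and `z ≠ w`.
  refine integral_real_eq_zero_of_half_plane (C := 2 * C) (T₀ := 2 * ‖w‖ + 1)
    ((continuousOn_dslope hnh').2 ⟨hg.continuousOn, hg.differentiableOn.differentiableAt hnh⟩)
    ((Complex.differentiableOn_dslope hnh).2 hg.differentiableOn) ?_ fun z hz hzT => ?_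
  · simp only [hval']
    exact hg.integrable_mul_inv_sub hw.ne'
  · have hw0 := norm_nonneg w
    have h1 : z ≠ w := by
      rintro rfl
      linarith
    have h2 : ‖z‖ / 2 ≤ ‖z - w‖ := by linarith [norm_sub_norm_le z w]
    have h3 : 0 < ‖z‖ := by linarith
    rw [hval z h1, norm_mul, norm_inv]
    calc ‖g z‖ * ‖z - w‖⁻¹ ≤ C / ‖z‖ * (‖z‖ / 2)⁻¹ := by
          gcongr
          exact (hg.bound z hz).trans (by gcongr; linarith)
      _ = 2 * C / ‖z‖ ^ 2 := by field_simp

end HasHalfPlaneDecay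

lemma integral_inv_sub_sq_add_sq (u : ℝ) {v : ℝ} (hv : 0 < v) :
    ∫ r : ℝ, ((r - u) ^ 2 + v ^ 2)⁻¹ = Real.pi / v := by
  rw [integral_sub_right_eq_self (fun r : ℝ => (r ^ 2 + v ^ 2)⁻¹)]
  have h : ∀ r : ℝ, (r ^ 2 + v ^ 2)⁻¹ = (v ^ 2)⁻¹ * (1 + (r / v) ^ 2)⁻¹ := fun r => by
    rw [← mul_inv]
    congr 1
    field_simp
    ring
  simp only [h]
  rw [integral_const_mul, Measure.integral_comp_div (fun r : ℝ => (1 + r ^ 2)⁻¹),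
    integral_univ_inv_one_add_sq, abs_of_pos hv, smul_eq_mul]
  field_simp

/-- A multiple of the kernel with pole at the conjugate of `w` matches `g` at `w`, and the
difference integrates to zero. The kernel itself leaves a Poisson integral, equal to `π / Im w`. -/
theorem HasHalfPlaneDecay.integral_mul_inv_sub {g : ℂ → ℂ} {C : ℝ} (hg : HasHalfPlaneDecay g C)
    {w : ℂ} (hw : 0 < w.im) :
    ∫ r : ℝ, g r * ((r : ℂ) - w)⁻¹ = 2 * Real.pi * Complex.I * g w := by
  set w' : ℂ := (starRingEnd ℂ) w with hw'
  have him : w'.im = -w.im := Complex.conj_im w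
  have hne : ∀ z : ℂ, 0 ≤ z.im → z - w' ≠ 0 := fun z hz h => by
    have := congrArg Complex.im h
    rw [Complex.sub_im, him, Complex.zero_im] at this
    linarith
  set k : ℂ → ℂ := fun z => g w * (w - w') * (z - w')⁻¹ with hk
  have hkd : ∀ z : ℂ, 0 ≤ z.im → DifferentiableAt ℂ k z := fun z hz => by
    have : DifferentiableAt ℂ (fun z => z - w') z := by fun_prop
    exact (this.fun_inv (hne z hz)).const_mul _
  have hkb : ∀ z : ℂ, 0 ≤ z.im →
      ‖k z‖ ≤ ‖g w * (w - w')‖ * ((1 + ‖w'‖) / w.im + 1) / (1 + ‖z‖) := fun z hz => by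
    rw [hk, norm_mul, mul_div_assoc]
    gcongr
    refine norm_inv_sub_le hw ?_
    rw [Complex.sub_im, him]
    exact le_trans (by linarith) (le_abs_self _)
  set D := ‖g w * (w - w')‖ * ((1 + ‖w'‖) / w.im + 1)
  have hkH : HasHalfPlaneDecay k D :=
    ⟨fun z hz => (hkd z hz).continuousAt.continuousWithinAt,
      fun z hz => (hkd z (le_of_lt hz)).differentiableWithinAt, hkb⟩
  have hG : HasHalfPlaneDecay (fun z => g z - k z) (C + D) :=
    ⟨hg.continuousOn.sub hkH.continuousOn, hg.differentiableOn.sub hkH.differentiableOn,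
      fun z hz => (norm_sub_le _ _).trans ((add_le_add (hg.bound z hz) (hkb z hz)).trans_eq
        (add_div _ _ _).symm)⟩
  have h0 := hG.integral_mul_inv_sub_eq_zero hw (by
    simp only [hk]
    rw [mul_assoc, mul_inv_cancel₀ (hne w hw.le), mul_one, sub_self])
  simp only [sub_mul] at h0
  rw [integral_sub (hg.integrable_mul_inv_sub hw.ne') (hkH.integrable_mul_inv_sub hw.ne'),
    sub_eq_zero] at h0
  rw [h0]
  have h1 : ∀ r : ℝ, k r * ((r : ℂ) - w)⁻¹
      = g w * (w - w') * ((((r - w.re) ^ 2 + w.im ^ 2)⁻¹ : ℝ) : ℂ) := fun r => by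
    simp only [hk]
    rw [mul_assoc, ← mul_inv]
    congr 1
    rw [Complex.ofReal_inv]
    congr 1
    apply Complex.ext <;> simp [hw', pow_two]
    ring
  simp only [h1]
  rw [integral_const_mul, integral_complex_ofReal, integral_inv_sub_sq_add_sq _ hw, hw',
    Complex.sub_conj]
  have : (w.im : ℂ) ≠ 0 := by exact_mod_cast hw.ne'
  push_cast
  field_simp

/-! ### Uniqueness of the amplitude -/

section Fourier

open FourierTransform

lemma integral_fourier_mul_eq_flip {u v : ℝ → ℂ} (hu : Integrable u) (hv : Integrable v) :
    ∫ ξ, 𝓕 u ξ * v ξ = ∫ x, u x * 𝓕 v x := by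
  have h := VectorFourier.integral_fourierIntegral_smul_eq_flip (L := innerₗ ℝ)
    (μ := volume) (ν := volume) Real.continuous_fourierChar continuous_inner hu hv
  rw [flip_innerₗ] at h
  exact h

/-- Every test function is the transform of a Schwartz function, so the multiplication formula
annihilates its pairing with `u`. -/
lemma ae_eq_zero_of_fourier_eq_zero {u : ℝ → ℂ} (hu : Integrable u) (h : 𝓕 u = 0) :
    u =ᵐ[volume] 0 := by
  refine ae_eq_zero_of_integral_contDiff_smul_eq_zero hu.locallyIntegrable fun g hg hgc => ?_
  have hg₁ : HasCompactSupport (Complex.ofRealCLM ∘ g) := hgc.comp_left rfl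
  have hg₂ : ContDiff ℝ (⊤ : ℕ∞) (Complex.ofRealCLM ∘ g) := by fun_prop
  set φ : SchwartzMap ℝ ℂ := hg₁.toSchwartzMap hg₂ with hφ
  set ψ : SchwartzMap ℝ ℂ := 𝓕⁻ φ
  have h1 : 𝓕 (ψ : ℝ → ℂ) = φ := by
    rw [← SchwartzMap.fourier_coe]
    congr 1
    exact FourierTransform.fourier_fourierInv_eq φ
  have h2 := integral_fourier_mul_eq_flip ψ.integrable hu
  rw [h1, h] at h2
  simpa [hφ] using h2

end Fourier

/-- Along the line `Im θ = y` the integrals are Fourier transforms of `F(κ) e^{-yκ}` and `G(κ)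
e^{-yκ}` on the half-line, so a single line determines the amplitude. -/
lemma ae_eq_of_integral_exp_eq {F G : ℝ → ℂ} {y : ℝ}
    (hF : ∀ θ : ℂ, θ.im = y →
      IntegrableOn (fun κ : ℝ => F κ * Complex.exp (Complex.I * κ * θ)) (Ioi 0))
    (hG : ∀ θ : ℂ, θ.im = y →
      IntegrableOn (fun κ : ℝ => G κ * Complex.exp (Complex.I * κ * θ)) (Ioi 0))
    (h : ∀ θ : ℂ, θ.im = y → ∫ κ in Ioi (0 : ℝ), F κ * Complex.exp (Complex.I * κ * θ)
      = ∫ κ in Ioi (0 : ℝ), G κ * Complex.exp (Complex.I * κ * θ)) :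
    F =ᵐ[volume.restrict (Ioi 0)] G := by
  set θ₀ : ℂ := Complex.I * y with hθ₀
  have hy : θ₀.im = y := by simp [hθ₀]
  set u : ℝ → ℂ := fun κ => F κ * Complex.exp (Complex.I * κ * θ₀)
    - G κ * Complex.exp (Complex.I * κ * θ₀) with hu
  have hui : IntegrableOn u (Ioi 0) := (hF θ₀ hy).sub (hG θ₀ hy)
  have h0 := ae_eq_zero_of_fourier_eq_zero (hui.integrable_indicator measurableSet_Ioi) (by
    ext ξ
    rw [Real.fourier_real_eq_integral_exp_smul]
    have e : ∀ κ : ℝ, Complex.exp ((-2 * Real.pi * κ * ξ : ℝ) * Complex.I) • (Ioi 0).indicator u κ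
        = (Ioi 0).indicator (fun κ : ℝ =>
          F κ * Complex.exp (Complex.I * κ * (θ₀ - (2 * Real.pi * ξ : ℝ)))
          - G κ * Complex.exp (Complex.I * κ * (θ₀ - (2 * Real.pi * ξ : ℝ)))) κ := fun κ => by
      by_cases hκ : κ ∈ Ioi (0 : ℝ)
      · rw [indicator_of_mem hκ, indicator_of_mem hκ, hu, smul_eq_mul]
        have : Complex.exp (Complex.I * κ * (θ₀ - (2 * Real.pi * ξ : ℝ)))
            = Complex.exp ((-2 * Real.pi * κ * ξ : ℝ) * Complex.I) *
              Complex.exp (Complex.I * κ * θ₀) := by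
          rw [← Complex.exp_add]
          congr 1
          push_cast
          ring
        rw [this]
        ring
      · rw [indicator_of_notMem hκ, indicator_of_notMem hκ, smul_zero]
    have him : (θ₀ - ((2 * Real.pi * ξ : ℝ) : ℂ)).im = y := by
      rw [Complex.sub_im, Complex.ofReal_im, sub_zero, hy]
    simp only [e]
    rw [integral_indicator measurableSet_Ioi, integral_sub (hF _ him) (hG _ him), h _ him, sub_self]
    rfl)
  rw [Filter.EventuallyEq, ae_restrict_iff' measurableSet_Ioi]
  filter_upwards [h0] with κ hκ hκ0
  rw [indicator_of_mem hκ0] at hκ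
  simp only [hu, Pi.zero_apply] at hκ
  rw [← sub_mul] at hκ
  exact sub_eq_zero.1 ((mul_eq_zero.1 hκ).resolve_right (Complex.exp_ne_zero _))

lemma IsFourierAmplitude.ae_eq {f : ℂ → ℂ} {F G : ℝ → ℂ} (hG : IsFourierAmplitude f G)
    (hF : IsFourierAmplitude f F) : G =ᵐ[volume.restrict (Ioi 0)] F := by
  have hpos : ∀ θ : ℂ, θ.im = 1 → 0 < θ.im := fun θ h => by rw [h]; exact one_pos
  exact ae_eq_of_integral_exp_eq (y := 1) (fun θ h => (hG θ (hpos θ h)).1)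
    (fun θ h => (hF θ (hpos θ h)).1)
    fun θ h => (hG θ (hpos θ h)).2.symm.trans (hF θ (hpos θ h)).2

/-! ### Existence of the amplitude of a waveform -/

lemma memLp_two_of_norm_le {u : ℝ → ℂ} {C : ℝ} (hu : AEStronglyMeasurable u)
    (huC : ∀ r, ‖u r‖ ≤ C / (1 + |r|)) :
    MemLp u 2 ∧ ∫ r, ‖u r‖ ^ 2 ≤ C ^ 2 * Real.pi := by
  have hb : ∀ r, ‖u r‖ ^ 2 ≤ C ^ 2 * (1 + r ^ 2)⁻¹ := fun r => by
    calc ‖u r‖ ^ 2 ≤ (C / (1 + |r|)) ^ 2 := by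
          gcongr
          exact huC r
      _ = C ^ 2 * ((1 + |r|) ^ 2)⁻¹ := by field_simp
      _ ≤ C ^ 2 * (1 + r ^ 2)⁻¹ := by
          gcongr
          nlinarith [abs_nonneg r, sq_abs r]
  have hi : Integrable fun r : ℝ => C ^ 2 * (1 + r ^ 2)⁻¹ :=
    integrable_inv_one_add_sq.const_mul _
  refine ⟨(memLp_two_iff_integrable_sq_norm hu).2 (hi.mono' (hu.norm.pow 2)
    (Eventually.of_forall fun r => ?_)), ?_⟩
  · rw [Real.norm_of_nonneg (sq_nonneg _)]
    exact hb r
  · refine (integral_mono_of_nonneg (Eventually.of_forall fun r => sq_nonneg _) hi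
      (Eventually.of_forall hb)).trans_eq ?_
    rw [integral_const_mul, integral_univ_inv_one_add_sq]

section Fourier

open FourierTransform ComplexConjugate

/-- Both sides are inner products with fixed elements of `L²`, hence continuous in `a`, and they
agree on the dense set of Schwartz functions. -/
lemma integral_Lp_fourier_mul_eq_flip (a : Lp (α := ℝ) ℂ 2) {v : ℝ → ℂ} (hv : Integrable v)
    (hv2 : MemLp v 2) (hFv : MemLp (𝓕 v) 2) :
    ∫ ξ, (𝓕 a : Lp (α := ℝ) ℂ 2) ξ * v ξ = ∫ x, a x * 𝓕 v x := by
  have hpair : ∀ {w : ℝ → ℂ} (hw : MemLp w 2) (b : Lp (α := ℝ) ℂ 2),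
      inner ℂ (hw.star.toLp (star w)) b = ∫ x, b x * w x := fun hw b => by
    rw [L2.inner_def]
    refine integral_congr_ae ?_
    filter_upwards [hw.star.coeFn_toLp] with x hx
    rw [hx, RCLike.inner_apply]
    simp
  rw [← hpair hv2, ← hpair hFv]
  refine DenseRange.induction_on
    (p := fun a : Lp (α := ℝ) ℂ 2 => inner ℂ (hv2.star.toLp (star v)) (𝓕 a)
      = inner ℂ (hFv.star.toLp (star (𝓕 v))) a)
    (SchwartzMap.denseRange_toLpCLM (F := ℂ) (p := 2) ENNReal.ofNat_ne_top) a
    (isClosed_eq ?_ ?_) fun φ => ?_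
  · exact continuous_const.inner (Lp.fourierTransformₗᵢ ℝ ℂ).continuous
  · exact continuous_const.inner continuous_id
  · rw [SchwartzMap.toLpCLM_apply, SchwartzMap.toLp_fourier_eq, hpair hv2, hpair hFv]
    have h1 : ∫ x, ((𝓕 φ).toLp 2 : ℝ → ℂ) x * v x = ∫ x, 𝓕 (φ : ℝ → ℂ) x * v x := by
      refine integral_congr_ae ?_
      filter_upwards [(𝓕 φ).coeFn_toLp 2 volume] with x hx
      rw [hx, SchwartzMap.fourier_coe]
    have h2 : ∫ x, (φ.toLp 2 : ℝ → ℂ) x * 𝓕 v x = ∫ x, φ x * 𝓕 v x := by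
      refine integral_congr_ae ?_
      filter_upwards [φ.coeFn_toLp 2 volume] with x hx
      rw [hx]
    rw [h1, h2]
    exact integral_fourier_mul_eq_flip φ.integrable hv

lemma integral_norm_sq_Lp_fourier (a : Lp (α := ℝ) ℂ 2) :
    ∫ ξ, ‖(𝓕 a : Lp (α := ℝ) ℂ 2) ξ‖ ^ 2 = ∫ x, ‖a x‖ ^ 2 := by
  have h := Lp.inner_fourier_eq a a
  rw [L2.inner_def, L2.inner_def] at h
  simp only [inner_self_eq_norm_sq_to_K] at h
  have e : ∀ b : Lp (α := ℝ) ℂ 2, ∫ x, ((‖b x‖ : ℂ)) ^ 2 = ((∫ x, ‖b x‖ ^ 2 : ℝ) : ℂ) := fun b => by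
    rw [← integral_complex_ofReal]
    push_cast
    rfl
  have h' := (e _).symm.trans (h.trans (e a))
  exact_mod_cast h'

/-- The exponential `e^{2πiξw}` cut off to the positive half-line. -/
noncomputable def halfExp (w : ℂ) : ℝ → ℂ :=
  (Ioi 0).indicator fun ξ : ℝ => Complex.exp (2 * Real.pi * Complex.I * w * ξ)

variable {w : ℂ}

lemma re_two_pi_I_mul (w : ℂ) : (2 * Real.pi * Complex.I * w).re = -(2 * Real.pi * w.im) := by
  simp

lemma integrable_halfExp (hw : 0 < w.im) : Integrable (halfExp w) := by
  refine (integrableOn_exp_mul_complex_Ioi ?_ 0).integrable_indicator measurableSet_Ioi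
  rw [re_two_pi_I_mul]
  have := Real.pi_pos
  exact neg_lt_zero.2 (by positivity)

lemma memLp_halfExp (hw : 0 < w.im) : MemLp (halfExp w) 2 := by
  rw [memLp_two_iff_integrable_sq_norm (integrable_halfExp hw).aestronglyMeasurable]
  have h : Integrable ((Ioi 0).indicator fun ξ : ℝ =>
      Real.exp (-(4 * Real.pi * w.im) * ξ)) := by
    refine (integrableOn_exp_mul_Ioi ?_ 0).integrable_indicator measurableSet_Ioi
    have := Real.pi_pos
    exact neg_lt_zero.2 (by positivity)
  refine h.congr (Eventually.of_forall fun ξ => ?_)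
  simp only [halfExp]
  by_cases hξ : ξ ∈ Ioi (0 : ℝ)
  · rw [indicator_of_mem hξ, indicator_of_mem hξ, Complex.norm_exp, ← Real.exp_nat_mul]
    congr 1
    simp
    ring
  · rw [indicator_of_notMem hξ, indicator_of_notMem hξ]
    simp

/-- The Cauchy kernel is a Fourier transform; thus Cauchy's formula becomes a pairing to which the
multiplication formula applies. -/
lemma fourier_halfExp (hw : 0 < w.im) (s : ℝ) :
    𝓕 (halfExp w) s = (2 * Real.pi * Complex.I)⁻¹ * ((s : ℂ) - w)⁻¹ := by
  rw [Real.fourier_real_eq_integral_exp_smul]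
  have e : ∀ ξ : ℝ, Complex.exp ((-2 * Real.pi * ξ * s : ℝ) * Complex.I) • halfExp w ξ
      = (Ioi 0).indicator (fun ξ : ℝ =>
        Complex.exp ((2 * Real.pi * Complex.I * (w - s)) * ξ)) ξ := fun ξ => by
    simp only [halfExp]
    by_cases hξ : ξ ∈ Ioi (0 : ℝ)
    · rw [indicator_of_mem hξ, indicator_of_mem hξ, smul_eq_mul, ← Complex.exp_add]
      congr 1
      push_cast
      ring
    · rw [indicator_of_notMem hξ, indicator_of_notMem hξ, smul_zero]
  have hre : (2 * Real.pi * Complex.I * (w - s)).re < 0 := by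
    rw [re_two_pi_I_mul]
    have := Real.pi_pos
    have h1 : (w - (s : ℂ)).im = w.im := by simp
    rw [h1]
    exact neg_lt_zero.2 (by positivity)
  simp only [e]
  rw [integral_indicator measurableSet_Ioi, integral_exp_mul_complex_Ioi hre, ← mul_inv]
  simp only [Complex.ofReal_zero, mul_zero, Complex.exp_zero]
  rw [neg_div, ← div_neg, one_div]
  congr 1
  ring

/-- The Paley-Wiener representation of a decaying function in the half-plane. -/
theorem HasHalfPlaneDecay.exists_amplitude {g : ℂ → ℂ} {C : ℝ} (hg : HasHalfPlaneDecay g C) :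
    ∃ A : ℝ → ℂ, AEStronglyMeasurable A ∧ Integrable (fun ξ => ‖A ξ‖ ^ 2) ∧
      ∫ ξ, ‖A ξ‖ ^ 2 ≤ C ^ 2 * Real.pi ∧ ∀ w : ℂ, 0 < w.im →
        IntegrableOn (fun ξ : ℝ => A ξ * Complex.exp (2 * Real.pi * Complex.I * w * ξ)) (Ioi 0) ∧
        g w = ∫ ξ in Ioi (0 : ℝ), A ξ * Complex.exp (2 * Real.pi * Complex.I * w * ξ) := by
  obtain ⟨hm, hn⟩ := memLp_two_of_norm_le hg.continuous_real.aestronglyMeasurable hg.norm_real_le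
  set a : Lp (α := ℝ) ℂ 2 := hm.toLp _
  set A : Lp (α := ℝ) ℂ 2 volume := 𝓕 a with hA
  have hA2 : MemLp (A : ℝ → ℂ) 2 volume := Lp.memLp A
  refine ⟨fun ξ => A ξ, hA2.aestronglyMeasurable,
    (memLp_two_iff_integrable_sq_norm hA2.aestronglyMeasurable).1 hA2, ?_, fun w hw => ?_⟩
  · rw [hA, integral_norm_sq_Lp_fourier]
    refine le_trans (le_of_eq (integral_congr_ae ?_)) hn
    filter_upwards [hm.coeFn_toLp] with r hr
    rw [hr]
  · have hmul : ∀ ξ : ℝ, A ξ * halfExp w ξ = (Ioi 0).indicator (fun ξ : ℝ =>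
        A ξ * Complex.exp (2 * Real.pi * Complex.I * w * ξ)) ξ := fun ξ => by
      rw [halfExp, indicator_mul_right]
    have hint : Integrable fun ξ => A ξ * halfExp w ξ := hA2.integrable_mul (memLp_halfExp hw)
    have hF : MemLp (𝓕 (halfExp w)) 2 := by
      refine (memLp_two_of_norm_le (C := ‖(2 * Real.pi * Complex.I : ℂ)⁻¹‖ *
        ((1 + ‖w‖) / w.im + 1)) ?_ fun s => ?_).1
      · rw [funext (fourier_halfExp hw)]
        refine Continuous.aestronglyMeasurable (continuous_const.mul
          (Continuous.inv₀ (by fun_prop) fun s h => hw.ne' ?_))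
        simpa using congrArg Complex.im h
      · rw [fourier_halfExp hw, norm_mul, mul_div_assoc]
        gcongr
        have h := norm_inv_sub_le (z := s) (v := w) hw (by simp [abs_of_pos hw])
        rwa [Complex.norm_real, Real.norm_eq_abs] at h
    -- The left side is the desired representation, the right side is the Cauchy integral of `g` at
    -- `w`.
    have key := integral_Lp_fourier_mul_eq_flip a (integrable_halfExp hw) (memLp_halfExp hw) hF
    rw [← hA] at key
    simp only [hmul] at hint key
    refine ⟨(integrable_indicator_iff measurableSet_Ioi).1 hint, ?_⟩
    rw [integral_indicator measurableSet_Ioi] at key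
    rw [key]
    have h1 : ∫ r, a r * 𝓕 (halfExp w) r
        = ∫ r : ℝ, (2 * Real.pi * Complex.I)⁻¹ * (g r * ((r : ℂ) - w)⁻¹) := by
      refine integral_congr_ae ?_
      filter_upwards [hm.coeFn_toLp] with r hr
      rw [hr, fourier_halfExp hw]
      ring
    rw [h1, integral_const_mul, hg.integral_mul_inv_sub hw]
    have := Complex.two_pi_I_ne_zero
    field_simp

end Fourier

/-- The rescaling `κ = 2πξ` passes to the normalization of (1). What matters later is that the `L²`
bound depends on `C` only. -/
lemma HasHalfPlaneDecay.exists_amplitude' {g : ℂ → ℂ} {C : ℝ} (hg : HasHalfPlaneDecay g C) :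
    ∃ A : ℝ → ℂ, AEStronglyMeasurable A (volume.restrict (Ioi 0)) ∧
      IntegrableOn (fun κ => ‖A κ‖ ^ 2) (Ioi 0) ∧
      ∫ κ in Ioi (0 : ℝ), ‖A κ‖ ^ 2 ≤ C ^ 2 ∧ IsFourierAmplitude g A := by
  obtain ⟨A, hA, hA2, hAn, hAw⟩ := hg.exists_amplitude
  have hpi := Real.pi_pos
  have hq : 0 < (2 * Real.pi)⁻¹ := by positivity
  have hpi' : (Real.pi : ℂ) ≠ 0 := by exact_mod_cast hpi.ne'
  refine ⟨fun κ => ((2 * Real.pi)⁻¹ : ℝ) * A ((2 * Real.pi)⁻¹ * κ), ?_, ?_, ?_, fun w hw => ?_⟩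
  · refine AEStronglyMeasurable.const_mul ?_ _
    refine (hA.comp_quasiMeasurePreserving ?_).restrict
    exact Measure.quasiMeasurePreserving_smul volume hq.ne'
  · have h := (integrableOn_Ioi_comp_mul_left_iff (fun ξ => ‖A ξ‖ ^ 2) 0 hq).2
      (by rw [mul_zero]; exact hA2.integrableOn)
    refine (h.const_mul ((2 * Real.pi)⁻¹ ^ 2)).congr (Eventually.of_forall fun κ => ?_)
    simp only [norm_mul, mul_pow, Complex.norm_real, Real.norm_eq_abs, sq_abs]
  · have h : ∀ κ : ℝ, ‖(((2 * Real.pi)⁻¹ : ℝ) : ℂ) * A ((2 * Real.pi)⁻¹ * κ)‖ ^ 2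
        = (2 * Real.pi)⁻¹ ^ 2 * ‖A ((2 * Real.pi)⁻¹ * κ)‖ ^ 2 := fun κ => by
      rw [norm_mul, mul_pow, Complex.norm_real, Real.norm_eq_abs, sq_abs]
    simp only [h]
    rw [integral_const_mul, integral_comp_mul_left_Ioi (fun ξ => ‖A ξ‖ ^ 2) 0 hq, mul_zero,
      smul_eq_mul, inv_inv]
    have h1 : ∫ ξ in Ioi (0 : ℝ), ‖A ξ‖ ^ 2 ≤ C ^ 2 * Real.pi :=
      (setIntegral_le_integral hA2 (Eventually.of_forall fun ξ => sq_nonneg _)).trans hAn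
    calc (2 * Real.pi)⁻¹ ^ 2 * (2 * Real.pi * ∫ ξ in Ioi (0 : ℝ), ‖A ξ‖ ^ 2)
        ≤ (2 * Real.pi)⁻¹ ^ 2 * (2 * Real.pi * (C ^ 2 * Real.pi)) := by gcongr
      _ = C ^ 2 / 2 := by field_simp
      _ ≤ C ^ 2 := half_le_self (sq_nonneg _)
  · obtain ⟨h1, h2⟩ := hAw w hw
    have e : ∀ κ : ℝ, (((2 * Real.pi)⁻¹ : ℝ) : ℂ) * A ((2 * Real.pi)⁻¹ * κ) *
        Complex.exp (Complex.I * κ * w) = (((2 * Real.pi)⁻¹ : ℝ) : ℂ) *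
          (A ((2 * Real.pi)⁻¹ * κ) *
            Complex.exp (2 * Real.pi * Complex.I * w * ((2 * Real.pi)⁻¹ * κ : ℝ))) := fun κ => by
      rw [mul_assoc]
      congr 3
      push_cast
      field_simp
    simp only [e]
    refine ⟨?_, ?_⟩
    · refine Integrable.const_mul ?_ _
      exact (integrableOn_Ioi_comp_mul_left_iff (fun ξ : ℝ =>
        A ξ * Complex.exp (2 * Real.pi * Complex.I * w * ξ)) 0 hq).2 (by rwa [mul_zero])
    · rw [integral_const_mul, integral_comp_mul_left_Ioi (fun ξ : ℝ =>
        A ξ * Complex.exp (2 * Real.pi * Complex.I * w * ξ)) 0 hq, mul_zero, h2, inv_inv,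
        Complex.real_smul]
      push_cast
      field_simp

/-- Moving up in the upper half-plane increases the modulus, so one constant serves all `ε`. -/
lemma IsWaveform.hasHalfPlaneDecay_shift {f : ℂ → ℂ} {C : ℝ}
    (hf : DifferentiableOn ℂ f {θ : ℂ | 0 < θ.im})
    (hC : ∀ θ : ℂ, 0 < θ.im → ‖f θ‖ ≤ C / (1 + ‖θ‖)) {ε : ℝ} (hε : 0 < ε) :
    HasHalfPlaneDecay (fun z => f (z + Complex.I * ε)) C := by
  have him : ∀ z : ℂ, 0 ≤ z.im → 0 < (z + Complex.I * ε).im := fun z hz => by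
    simpa using add_pos_of_nonneg_of_pos hz hε
  have hd : ∀ z : ℂ, 0 ≤ z.im → DifferentiableAt ℂ (fun z => f (z + Complex.I * ε)) z :=
    fun z hz => by
      have h1 : DifferentiableAt ℂ f (z + Complex.I * ε) := hf.differentiableAt
        ((isOpen_lt continuous_const Complex.continuous_im).mem_nhds (him z hz))
      exact h1.comp z (by fun_prop : DifferentiableAt ℂ (fun z => z + Complex.I * (ε : ℂ)) z)
  have hC0 : 0 ≤ C := by
    have h := (norm_nonneg _).trans (hC Complex.I (by simp))
    by_contra! hneg
    exact absurd h (not_le.2 (div_neg_of_neg_of_pos hneg (by positivity)))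
  refine ⟨fun z hz => (hd z hz).continuousAt.continuousWithinAt,
    fun z (hz : 0 < z.im) => (hd z hz.le).differentiableWithinAt, fun z hz => ?_⟩
  refine (hC _ (him z hz)).trans ?_
  gcongr
  rw [← sq_le_sq₀ (norm_nonneg _) (norm_nonneg _), ← Complex.normSq_eq_norm_sq,
    ← Complex.normSq_eq_norm_sq, Complex.normSq_apply, Complex.normSq_apply]
  simp
  nlinarith [mul_nonneg hz hε.le]

/-- The amplitude of the shift by `iε` should be `F(κ) e^{-εκ}`. Undoing this factor gives
candidates that agree almost everywhere for all `ε ≤ 1`, hence represent `f` at every height. -/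
theorem IsWaveform.exists_amplitude {f : ℂ → ℂ} (hf : IsWaveform f) :
    ∃ F : ℝ → ℂ, IsFourierAmplitude f F ∧ MemLp F 2 (volume.restrict (Ioi 0)) := by
  obtain ⟨hd, C, hC⟩ := hf
  have hstep : ∀ ε : ℝ, 0 < ε → ∃ A : ℝ → ℂ, AEStronglyMeasurable A (volume.restrict (Ioi 0)) ∧
      IntegrableOn (fun κ => ‖A κ‖ ^ 2) (Ioi 0) ∧ ∫ κ in Ioi (0 : ℝ), ‖A κ‖ ^ 2 ≤ C ^ 2 ∧
      IsFourierAmplitude (fun z => f (z + Complex.I * ε)) A := fun ε hε =>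
    (IsWaveform.hasHalfPlaneDecay_shift hd hC hε).exists_amplitude'
  choose! A hAm hA2 hAn hAf using hstep
  set F : ℝ → ℝ → ℂ := fun ε κ => A ε κ * Real.exp (ε * κ) with hFdef
  have hFA : ∀ ε κ : ℝ, ∀ θ : ℂ, F ε κ * Complex.exp (Complex.I * κ * θ)
      = A ε κ * Complex.exp (Complex.I * κ * (θ - Complex.I * ε)) := fun ε κ θ => by
    rw [hFdef]
    simp only
    rw [mul_assoc, Complex.ofReal_exp, ← Complex.exp_add]
    congr 2
    push_cast
    linear_combination ((κ : ℂ) * ε) * Complex.I_sq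
  have hF : ∀ ε : ℝ, 0 < ε → ∀ θ : ℂ, ε < θ.im →
      IntegrableOn (fun κ : ℝ => F ε κ * Complex.exp (Complex.I * κ * θ)) (Ioi 0) ∧
      f θ = ∫ κ in Ioi (0 : ℝ), F ε κ * Complex.exp (Complex.I * κ * θ) := fun ε hε θ hθ => by
    have h := hAf ε hε (θ - Complex.I * ε) (by simpa using hθ)
    simp only [hFA]
    simp only [sub_add_cancel] at h
    exact h
  -- The line `Im θ = 2` lies above every height `ε ≤ 1`, so all candidates represent `f` there.
  have hae : ∀ ε : ℝ, 0 < ε → ε ≤ 1 → F 1 =ᵐ[volume.restrict (Ioi 0)] F ε := fun ε hε hε1 => by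
    have h1 : ∀ θ : ℂ, θ.im = 2 → 1 < θ.im := fun θ h => by rw [h]; norm_num
    exact ae_eq_of_integral_exp_eq (y := 2) (fun θ h => (hF 1 one_pos θ (h1 θ h)).1)
      (fun θ h => (hF ε hε θ (hε1.trans_lt (h1 θ h))).1)
      fun θ h => (hF 1 one_pos θ (h1 θ h)).2.symm.trans (hF ε hε θ (hε1.trans_lt (h1 θ h))).2
  have hamp : IsFourierAmplitude f (F 1) := fun θ hθ => by
    have hε : 0 < min (θ.im / 2) 1 := lt_min (half_pos hθ) one_pos
    obtain ⟨h1, h2⟩ := hF _ hε θ ((min_le_left _ _).trans_lt (half_lt_self hθ))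
    have h3 := hae _ hε (min_le_right _ _)
    have h4 : (fun κ : ℝ => F (min (θ.im / 2) 1) κ * Complex.exp (Complex.I * κ * θ))
        =ᵐ[volume.restrict (Ioi 0)] fun κ : ℝ => F 1 κ * Complex.exp (Complex.I * κ * θ) := by
      filter_upwards [h3] with κ hκ
      rw [hκ]
    exact ⟨h1.congr h4, h2.trans (integral_congr_ae h4)⟩
  have hm : AEStronglyMeasurable (F 1) (volume.restrict (Ioi 0)) :=
    (hAm 1 one_pos).mul (Continuous.aestronglyMeasurable (by fun_prop))
  refine ⟨F 1, hamp, (memLp_two_iff_integrable_sq_norm hm).2 ?_⟩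
  have hsq : ∀ ε : ℝ, 0 < ε → ∀ K : ℝ, IntegrableOn (fun κ => ‖F ε κ‖ ^ 2) (Ioc 0 K) :=
    fun ε hε K => by
      have h1 := ((hA2 ε hε).mono_set Ioc_subset_Ioi_self).mul_continuousOn_of_subset
        (K := Icc 0 K) (g' := fun κ => Real.exp (ε * κ) ^ 2) (by fun_prop) measurableSet_Ioc
        isCompact_Icc Ioc_subset_Icc_self
      refine h1.congr_fun (fun κ _ => ?_) measurableSet_Ioc
      simp only [hFdef]
      rw [norm_mul, mul_pow, Complex.norm_real, Real.norm_eq_abs, Real.abs_exp]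
  -- On `(0, K]` the candidate with `ε = 1/K` is used: there `e^{εκ} ≤ e`, which gives a bound
  -- independent of `K`.
  refine integrableOn_Ioi_of_intervalIntegral_norm_bounded (Real.exp 1 ^ 2 * C ^ 2) 0
    (fun K => hsq 1 one_pos K) tendsto_id ?_
  filter_upwards [eventually_ge_atTop 1] with K hK
  have hK0 : 0 < K := one_pos.trans_le hK
  have hε : 0 < K⁻¹ := inv_pos.2 hK0
  rw [intervalIntegral.integral_of_le hK0.le]
  have h1 : ∫ κ in Ioc 0 K, ‖‖F 1 κ‖ ^ 2‖ = ∫ κ in Ioc 0 K, ‖F K⁻¹ κ‖ ^ 2 := by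
    refine integral_congr_ae ?_
    filter_upwards [ae_restrict_of_ae_restrict_of_subset Ioc_subset_Ioi_self
      (hae K⁻¹ hε (inv_le_one_of_one_le₀ hK))] with κ hκ
    rw [hκ, Real.norm_of_nonneg (sq_nonneg _)]
  rw [h1]
  have hA2K : IntegrableOn (fun κ => ‖A K⁻¹ κ‖ ^ 2) (Ioc 0 K) :=
    (hA2 _ hε).mono_set Ioc_subset_Ioi_self
  calc ∫ κ in Ioc 0 K, ‖F K⁻¹ κ‖ ^ 2
      ≤ ∫ κ in Ioc 0 K, Real.exp 1 ^ 2 * ‖A K⁻¹ κ‖ ^ 2 := by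
        refine setIntegral_mono_on (hsq _ hε K) (hA2K.const_mul _) measurableSet_Ioc
          fun κ hκ => ?_
        simp only [hFdef]
        rw [norm_mul, mul_pow, Complex.norm_real, Real.norm_eq_abs, Real.abs_exp, mul_comm]
        gcongr
        rw [inv_mul_le_iff₀ hK0, mul_one]
        exact hκ.2
    _ = Real.exp 1 ^ 2 * ∫ κ in Ioc 0 K, ‖A K⁻¹ κ‖ ^ 2 := integral_const_mul _ _
    _ ≤ Real.exp 1 ^ 2 * C ^ 2 := by
        gcongr
        refine le_trans ?_ (hAn _ hε)
        exact setIntegral_mono_set (hA2 _ hε) (Eventually.of_forall fun κ => sq_nonneg _)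
          (Eventually.of_forall fun κ h => Ioc_subset_Ioi_self h)

/-! ### The amplitude formula at real points -/

lemma IsWaveform.exists_hasHalfPlaneDecay {f : ℂ → ℂ} (hf : IsWaveform f)
    (hc : ContinuousOn f {θ : ℂ | 0 ≤ θ.im}) : ∃ C, HasHalfPlaneDecay f C := by
  obtain ⟨hd, C, hC⟩ := hf
  have hcl : closure {θ : ℂ | 0 < θ.im} = {θ : ℂ | 0 ≤ θ.im} := Complex.closure_setOfPred_lt_im 0
  refine ⟨C, hc, hd, fun z hz => ?_⟩
  refine le_on_closure (s := {θ : ℂ | 0 < θ.im}) hC ?_ ?_ (hcl ▸ hz)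
  · rw [hcl]
    exact hc.norm
  · exact Continuous.continuousOn (continuous_const.div (by fun_prop) fun θ => by positivity)

/-- Difference quotients of a decaying function at a real zero of differentiability are
integrable. -/
lemma HasHalfPlaneDecay.integrable_mul_inv_sub_real {h : ℂ → ℂ} {C : ℝ}
    (hh : HasHalfPlaneDecay h C) {s : ℝ} (hs : h s = 0)
    (hd : DifferentiableAt ℝ (fun r : ℝ => h r) s) :
    Integrable fun r : ℝ => h r * ((r : ℂ) - s)⁻¹ := by
  have hO := hd.isBigO_sub
  simp only [hs, sub_zero] at hO
  obtain ⟨M, hM0, hM⟩ := hO.exists_pos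
  obtain ⟨δ, hδ, hball⟩ := Metric.eventually_nhds_iff.1 hM.bound
  have hC : 0 ≤ C := by simpa using (norm_nonneg _).trans (hh.norm_real_le 0)
  -- Within `δ` of `s` differentiability bounds the quotient by `M`; farther away the kernel is at
  -- most `D/(1 + |r|)`.
  set D := (1 + |s|) / δ + 1 with hD
  have hD0 : 0 ≤ D := by positivity
  have hI1 : Integrable ((Ioo (s - δ) (s + δ)).indicator fun _ : ℝ => M) :=
    (integrable_indicator_iff measurableSet_Ioo).2 (integrableOn_const (by simp))
  have hI2 : Integrable fun r : ℝ => C * D * (1 + r ^ 2)⁻¹ :=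
    integrable_inv_one_add_sq.const_mul _
  refine (hI1.add hI2).mono' ?_ (Eventually.of_forall fun r => ?_)
  · refine hh.continuous_real.aestronglyMeasurable.mul (Measurable.aestronglyMeasurable ?_)
    fun_prop
  · have hnn : 0 ≤ C * D * (1 + r ^ 2)⁻¹ := by positivity
    have hnorm : ‖((r : ℂ) - s)⁻¹‖ = |r - s|⁻¹ := by
      rw [norm_inv, ← Complex.ofReal_sub, Complex.norm_real, Real.norm_eq_abs]
    rw [norm_mul, hnorm, Pi.add_apply]
    by_cases hr : |r - s| < δ
    · rw [indicator_of_mem (show r ∈ Ioo (s - δ) (s + δ) by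
        rw [abs_lt] at hr
        constructor <;> linarith)]
      have h1 := hball (y := r) (by rwa [Real.dist_eq])
      rw [Real.norm_eq_abs] at h1
      have h2 : ‖h r‖ * |r - s|⁻¹ ≤ M := by
        by_cases h0 : |r - s| = 0
        · rw [h0, inv_zero, mul_zero]
          exact hM0.le
        · have : 0 < |r - s| := lt_of_le_of_ne (abs_nonneg _) (Ne.symm h0)
          rwa [← div_eq_mul_inv, div_le_iff₀ this]
      linarith
    · rw [not_lt] at hr
      have hrs : 0 < |r - s| := hδ.trans_le hr
      have h1 : |r - s|⁻¹ ≤ D / (1 + |r|) := by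
        rw [inv_eq_one_div, div_le_div_iff₀ hrs (by positivity), one_mul]
        have h2 : |r| ≤ |r - s| + |s| := by simpa using abs_add_le (r - s) s
        have h3 : 1 + |s| ≤ (1 + |s|) / δ * |r - s| := by
          rw [div_mul_eq_mul_div, le_div_iff₀ hδ]
          gcongr
        rw [hD]
        linarith
      have h4 : 0 ≤ (Ioo (s - δ) (s + δ)).indicator (fun _ : ℝ => M) r :=
        indicator_nonneg (fun _ _ => hM0.le) r
      calc ‖h r‖ * |r - s|⁻¹ ≤ C / (1 + |r|) * (D / (1 + |r|)) := by
            exact mul_le_mul (hh.norm_real_le r) h1 (by positivity) (by positivity)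
        _ = C * D * ((1 + |r|) ^ 2)⁻¹ := by field_simp
        _ ≤ C * D * (1 + r ^ 2)⁻¹ := by
            gcongr
            nlinarith [abs_nonneg r, sq_abs r]
        _ ≤ _ := le_add_of_nonneg_left h4

/-- Cauchy's formula for the difference quotient at a real point. -/
lemma HasHalfPlaneDecay.integral_quotient_mul_inv_sub {h : ℂ → ℂ} {C : ℝ}
    (hh : HasHalfPlaneDecay h C) {s : ℝ} (hs : h s = 0)
    (hi : Integrable fun r : ℝ => h r * ((r : ℂ) - s)⁻¹) {w : ℂ} (hw : 0 < w.im) :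
    ∫ r : ℝ, h r * ((r : ℂ) - s)⁻¹ * ((r : ℂ) - w)⁻¹
      = 2 * Real.pi * Complex.I * (h w * (w - s)⁻¹) := by
  have hC : 0 ≤ C := by simpa using (norm_nonneg _).trans (hh.norm_real_le 0)
  have hws : w - s ≠ 0 := fun h => hw.ne' (by simpa using congrArg Complex.im h)
  -- The pole `s` is pushed to `s - iε`, below the real line, where Cauchy's formula applies. As `ε
  -- → 0` the quotient at `s` dominates, since `|r - s| ≤ |r - s + iε|`; at `r = s` the zero of `h`
  -- makes every integrand vanish.
  have key : ∀ ε : ℝ, 0 < ε →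
      ∫ r : ℝ, h r * ((r : ℂ) - (s - Complex.I * ε))⁻¹ * ((r : ℂ) - w)⁻¹
        = 2 * Real.pi * Complex.I * (h w * (w - (s - Complex.I * ε))⁻¹) := fun ε hε => by
    have him : ∀ z : ℂ, (z - (s - Complex.I * ε)).im = z.im + ε := fun z => by simp
    have hne : ∀ z : ℂ, 0 ≤ z.im → z - (s - Complex.I * ε) ≠ 0 := fun z hz h => by
      have := congrArg Complex.im h
      rw [him, Complex.zero_im] at this
      linarith
    have hid : ∀ z : ℂ, 0 ≤ z.im →
        DifferentiableAt ℂ (fun z : ℂ => (z - (s - Complex.I * ε))⁻¹) z := fun z hz =>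
      (by fun_prop : DifferentiableAt ℂ (fun z : ℂ => z - (s - Complex.I * ε)) z).fun_inv (hne z hz)
    have hH : HasHalfPlaneDecay (fun z => h z * (z - (s - Complex.I * ε))⁻¹) (C * ε⁻¹) := by
      refine ⟨hh.continuousOn.mul fun z hz => (hid z hz).continuousAt.continuousWithinAt,
        hh.differentiableOn.mul fun z (hz : 0 < z.im) => (hid z hz.le).differentiableWithinAt,
        fun z hz => ?_⟩
      rw [norm_mul, mul_div_right_comm]
      refine mul_le_mul (hh.bound z hz) ?_ (norm_nonneg _) (by positivity)
      rw [norm_inv]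
      refine inv_anti₀ hε (le_trans ?_ (Complex.abs_im_le_norm _))
      rw [him]
      exact le_trans (by linarith) (le_abs_self _)
    exact hH.integral_mul_inv_sub hw
  have hε : Tendsto (fun n : ℕ => (1 : ℝ) / (n + 1)) atTop (𝓝 0) :=
    tendsto_one_div_add_atTop_nhds_zero_nat
  have hv : ∀ v : ℂ, Tendsto (fun n : ℕ => v - (s - Complex.I * ((1 / (n + 1) : ℝ) : ℂ))) atTop
      (𝓝 (v - s)) := fun v => by
    have h1 : Tendsto (fun n : ℕ => v - (s - Complex.I * ((1 / (n + 1) : ℝ) : ℂ))) atTop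
        (𝓝 (v - (s - Complex.I * ((0 : ℝ) : ℂ)))) :=
      ((((Complex.continuous_ofReal.tendsto _).comp hε).const_mul Complex.I).const_sub
        (s : ℂ)).const_sub v
    simpa using h1
  have hL : Tendsto (fun n : ℕ => ∫ r : ℝ,
      h r * ((r : ℂ) - (s - Complex.I * ((1 / (n + 1) : ℝ) : ℂ)))⁻¹ * ((r : ℂ) - w)⁻¹) atTop
      (𝓝 (∫ r : ℝ, h r * ((r : ℂ) - s)⁻¹ * ((r : ℂ) - w)⁻¹)) := by
    refine tendsto_integral_of_dominated_convergence
      (fun r => ‖h r * ((r : ℂ) - s)⁻¹‖ * w.im⁻¹) (fun n => ?_) (hi.norm.mul_const _)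
      (fun n => Eventually.of_forall fun r => ?_) (Eventually.of_forall fun r => ?_)
    · refine (hh.continuous_real.aestronglyMeasurable.mul
        (Measurable.aestronglyMeasurable ?_)).mul (Measurable.aestronglyMeasurable ?_)
      · fun_prop
      · fun_prop
    · rw [norm_mul]
      have h2 : ‖((r : ℂ) - w)⁻¹‖ ≤ w.im⁻¹ := by
        rw [norm_inv]
        refine inv_anti₀ hw (le_trans ?_ (Complex.abs_im_le_norm _))
        simp [le_abs_self]
      refine mul_le_mul ?_ h2 (norm_nonneg _) (norm_nonneg _)
      by_cases hr : r = s
      · rw [hr, hs]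
        simp
      · rw [norm_mul, norm_mul, norm_inv, norm_inv]
        refine mul_le_mul_of_nonneg_left (inv_anti₀ ?_ ?_) (norm_nonneg _)
        · rw [norm_pos_iff, sub_ne_zero]
          exact_mod_cast hr
        · rw [← Complex.ofReal_sub, Complex.norm_real, Real.norm_eq_abs]
          refine le_trans (le_of_eq ?_) (Complex.abs_re_le_norm _)
          simp
    · by_cases hr : r = s
      · rw [hr, hs]
        simp
      · exact (((hv r).inv₀ (sub_ne_zero.2 (by exact_mod_cast hr))).const_mul _).mul_const _
  have hR : Tendsto (fun n : ℕ => 2 * Real.pi * Complex.I *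
      (h w * (w - (s - Complex.I * ((1 / (n + 1) : ℝ) : ℂ)))⁻¹)) atTop
      (𝓝 (2 * Real.pi * Complex.I * (h w * (w - s)⁻¹))) :=
    (((hv w).inv₀ hws).const_mul _).const_mul _
  exact tendsto_nhds_unique hL (hR.congr fun n => (key _ (by positivity)).symm)

/-- The Fourier integral of an integrable boundary function as an amplitude. -/
lemma amplitude_of_integrable {g : ℝ → ℂ} (hg : Integrable g) {w : ℂ} (hw : 0 < w.im) :
    IntegrableOn (fun κ : ℝ => (∫ r : ℝ, Complex.exp (-(Complex.I * κ * r)) * g r) *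
      Complex.exp (Complex.I * κ * w)) (Ioi 0) ∧
    ∫ κ in Ioi (0 : ℝ), (∫ r : ℝ, Complex.exp (-(Complex.I * κ * r)) * g r) *
      Complex.exp (Complex.I * κ * w) = -Complex.I * ∫ r : ℝ, g r * ((r : ℂ) - w)⁻¹ := by
  have hre : (Complex.I * w).re < 0 := by simpa using hw
  have he := integrableOn_exp_mul_complex_Ioi hre 0
  have hint : Integrable (Function.uncurry fun (κ r : ℝ) =>
      Complex.exp (-(Complex.I * κ * r)) * g r * Complex.exp (Complex.I * κ * w))
      ((volume.restrict (Ioi 0)).prod volume) := by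
    refine (he.norm.mul_prod hg.norm).mono' ?_ (Eventually.of_forall fun q => le_of_eq ?_)
    · refine AEStronglyMeasurable.mul (AEStronglyMeasurable.mul ?_
        hg.aestronglyMeasurable.comp_snd) ?_
      · exact Continuous.aestronglyMeasurable (by fun_prop)
      · exact Continuous.aestronglyMeasurable (by fun_prop)
    · simp only [Function.uncurry_def, norm_mul]
      have h1 : ‖Complex.exp (-(Complex.I * q.1 * q.2))‖ = 1 := by
        rw [Complex.norm_exp]
        simp
      rw [h1, one_mul, mul_comm, mul_right_comm Complex.I]
  refine ⟨?_, ?_⟩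
  · refine hint.integral_prod_left.congr (Eventually.of_forall fun κ => ?_)
    simp only [Function.uncurry_def]
    rw [integral_mul_const]
  · have h2 := integral_integral_swap hint
    simp only [integral_mul_const] at h2
    rw [h2, ← integral_const_mul]
    refine integral_congr_ae (Eventually.of_forall fun r => ?_)
    have hre' : (Complex.I * (w - r)).re < 0 := by simpa using hw
    have e : ∀ κ : ℝ, Complex.exp (-(Complex.I * κ * r)) * g r * Complex.exp (Complex.I * κ * w)
        = g r * Complex.exp (Complex.I * (w - r) * κ) := fun κ => by
      rw [mul_comm _ (g r), mul_assoc, ← Complex.exp_add]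
      congr 2
      ring
    have hne : (r : ℂ) - w ≠ 0 := fun h => hw.ne' (by simpa using congrArg Complex.im h)
    have hne' : w - (r : ℂ) ≠ 0 := fun h => hne (by rw [← neg_sub, h, neg_zero])
    simp only [e]
    rw [integral_const_mul, integral_exp_mul_complex_Ioi hre']
    simp only [Complex.ofReal_zero, mul_zero, Complex.exp_zero]
    have hI := Complex.I_ne_zero
    field_simp
    rw [Complex.I_sq]
    ring

section Fourier

open FourierTransform

lemma continuous_integral_exp_neg {g : ℝ → ℂ} (hg : Integrable g) :
    Continuous fun κ : ℝ => ∫ r : ℝ, Complex.exp (-(Complex.I * κ * r)) * g r := by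
  refine continuous_of_dominated (bound := fun r => ‖g r‖) (fun κ => ?_)
    (fun κ => Eventually.of_forall fun r => le_of_eq ?_) hg.norm
    (Eventually.of_forall fun r => by fun_prop)
  · exact (Continuous.aestronglyMeasurable (by fun_prop)).mul hg.aestronglyMeasurable
  · rw [norm_mul, Complex.norm_exp]
    simp

/-- The Riemann-Lebesgue lemma with `κ = 2πξ`; for nonintegrable `g` the integrals are `0` by
convention. -/
lemma tendsto_integral_exp_neg (g : ℝ → ℂ) :
    Tendsto (fun κ : ℝ => ∫ r : ℝ, Complex.exp (-(Complex.I * κ * r)) * g r) atTop (𝓝 0) := by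
  have h := (Real.zero_at_infty_fourier g).mono_left atTop_le_cocompact
  have hpi := Real.pi_pos
  refine (h.comp (tendsto_id.atTop_div_const (by positivity : 0 < 2 * Real.pi))).congr fun κ => ?_
  simp only [Function.comp_apply, id, Real.fourier_real_eq_integral_exp_smul, smul_eq_mul]
  refine integral_congr_ae (Eventually.of_forall fun r => ?_)
  simp only
  congr 2
  have hpi' : (Real.pi : ℂ) ≠ 0 := by exact_mod_cast hpi.ne'
  push_cast
  field_simp

end Fourier

/-- Primitives of an amplitude are amplitudes of quotients. -/
lemma IsFourierAmplitude.primitive {h : ℂ → ℂ} {H : ℝ → ℂ} (hH : IsFourierAmplitude h H) (s : ℝ)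
    {w : ℂ} (hw : 0 < w.im) :
    IntegrableOn (fun κ : ℝ => Complex.exp (-(Complex.I * κ * s)) *
      (∫ a in (0 : ℝ)..κ, H a * Complex.exp (Complex.I * a * s)) *
      Complex.exp (Complex.I * κ * w)) (Ioi 0) ∧
    ∫ κ in Ioi (0 : ℝ), Complex.exp (-(Complex.I * κ * s)) *
      (∫ a in (0 : ℝ)..κ, H a * Complex.exp (Complex.I * a * s)) *
      Complex.exp (Complex.I * κ * w) = Complex.I * (h w * (w - s)⁻¹) := by
  obtain ⟨h1, h2⟩ := hH w hw
  -- After Fubini the `k`-integral of `W` over `k > a` is `i/(w - s)` for every `a`, and the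
  -- `a`-integral that remains is `h w`.
  set W : ℝ → ℝ → ℂ := fun k a => Complex.exp (Complex.I * (k - a) * (w - s)) with hW
  have hWm : Measurable (Function.uncurry W) := by
    refine Continuous.measurable ?_
    simp only [hW, Function.uncurry_def]
    fun_prop
  have hWb : ∀ k a : ℝ, 0 < a → 1 * a < k →
      ‖W k a‖ ≤ 1 * Real.exp (-w.im * (k - 1 * a)) := fun k a _ _ => by
    rw [one_mul, one_mul, hW]
    simp only
    rw [Complex.norm_exp]
    refine le_of_eq (congrArg _ ?_)
    simp
    ring
  have e : ∀ κ : ℝ, ∫ a in (0 : ℝ)..(κ / 1), H a * Complex.exp (Complex.I * a * w) * W κ a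
      = Complex.exp (-(Complex.I * κ * s)) *
        (∫ a in (0 : ℝ)..κ, H a * Complex.exp (Complex.I * a * s)) *
        Complex.exp (Complex.I * κ * w) := fun κ => by
    rw [div_one, mul_right_comm, ← intervalIntegral.integral_const_mul]
    refine intervalIntegral.integral_congr fun a _ => ?_
    simp only [hW]
    rw [mul_assoc, ← Complex.exp_add, ← Complex.exp_add, mul_left_comm, ← Complex.exp_add]
    congr 2
    ring
  have h3 := integrableOn_integral_wedge one_pos hw h1 hWm hWb
  have h4 := integral_integral_wedge one_pos hw h1 hWm hWb
  simp only [e] at h3 h4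
  refine ⟨h3, h4.trans ?_⟩
  have hre : (Complex.I * (w - s)).re < 0 := by simpa using hw
  have hws : w - s ≠ 0 := fun h => hw.ne' (by simpa using congrArg Complex.im h)
  have hI : ∀ a : ℝ, ∫ k in Ioi (1 * a), W k a = Complex.I * (w - s)⁻¹ := fun a => by
    have e1 : ∀ k : ℝ, W k a = Complex.exp (-(Complex.I * (w - s) * a)) *
        Complex.exp (Complex.I * (w - s) * k) := fun k => by
      simp only [hW]
      rw [← Complex.exp_add]
      congr 1
      ring
    simp only [e1]
    rw [integral_const_mul, integral_exp_mul_complex_Ioi hre, one_mul, mul_div_assoc', mul_neg,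
      ← Complex.exp_add, neg_add_cancel, Complex.exp_zero]
    field_simp
    exact Complex.I_sq.symm
  simp only [hI]
  rw [integral_mul_const, ← h2]
  ring

/-- Two amplitudes of `i h(w)/(w - s)` are compared: `Φ`, made from the truncations of (1) at `s`,
and `Ψ`, a Fourier integral of the integrable boundary quotient. They agree, and `Ψ` vanishes at
infinity. -/
lemma IsFourierAmplitude.amplitudeFormulaAt_zero {h : ℂ → ℂ} {C : ℝ}
    (hh : HasHalfPlaneDecay h C) {H : ℝ → ℂ} (hH : IsFourierAmplitude h H) {s : ℝ} (hs : h s = 0)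
    (hd : DifferentiableAt ℝ (fun r : ℝ => h r) s) : AmplitudeFormulaAt h H s := by
  have hi := hh.integrable_mul_inv_sub_real hs hd
  set g : ℝ → ℂ := fun r => h r * ((r : ℂ) - s)⁻¹
  set Ψ : ℝ → ℂ := fun κ => Complex.I / (2 * Real.pi) *
    ∫ r : ℝ, Complex.exp (-(Complex.I * κ * r)) * g r with hΨ
  set Φ : ℝ → ℂ := fun κ => Complex.exp (-(Complex.I * κ * s)) *
    ∫ a in (0 : ℝ)..κ, H a * Complex.exp (Complex.I * a * s) with hΦ
  have hΨw : ∀ w : ℂ, 0 < w.im →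
      IntegrableOn (fun κ : ℝ => Ψ κ * Complex.exp (Complex.I * κ * w)) (Ioi 0) ∧
      ∫ κ in Ioi (0 : ℝ), Ψ κ * Complex.exp (Complex.I * κ * w)
        = Complex.I * (h w * (w - s)⁻¹) := fun w hw => by
    obtain ⟨h1, h2⟩ := amplitude_of_integrable hi hw
    simp only [hΨ, mul_assoc (Complex.I / (2 * (Real.pi : ℂ)))]
    refine ⟨h1.const_mul _, ?_⟩
    rw [integral_const_mul, h2, hh.integral_quotient_mul_inv_sub hs hi hw]
    have hpi : (Real.pi : ℂ) ≠ 0 := by exact_mod_cast Real.pi_ne_zero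
    generalize h w * (w - s)⁻¹ = q
    have e : Complex.I / (2 * (Real.pi : ℂ)) * (-Complex.I * (2 * Real.pi * Complex.I * q))
        = -Complex.I ^ 2 * (Complex.I * q) := by
      field_simp
    rw [e, Complex.I_sq, neg_neg, one_mul]
  have hpos : ∀ w : ℂ, w.im = 1 → 0 < w.im := fun w h => by rw [h]; exact one_pos
  have hae : Φ =ᵐ[volume.restrict (Ioi 0)] Ψ :=
    ae_eq_of_integral_exp_eq (y := 1) (fun w h => (hH.primitive s (hpos w h)).1)
      (fun w h => (hΨw w (hpos w h)).1)
      fun w h => (hH.primitive s (hpos w h)).2.trans (hΨw w (hpos w h)).2.symm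
  have hΨc : Continuous Ψ := continuous_const.mul (continuous_integral_exp_neg hi)
  have hΦc : ContinuousOn Φ (Ioi 0) := fun κ hκ => by
    have hκ' : (0 : ℝ) < κ := hκ
    have h1 : IntegrableOn (fun a : ℝ => H a * Complex.exp (Complex.I * a * s))
        (Icc 0 (κ + 1)) := by
      rw [integrableOn_Icc_iff_integrableOn_Ioc]
      exact (hH.integrableOn_Ioc _).mul_continuousOn_of_subset (K := Icc 0 (κ + 1)) (by fun_prop)
        measurableSet_Ioc isCompact_Icc Ioc_subset_Icc_self
    have h2 : ContinuousAt (fun κ : ℝ => ∫ a in (0 : ℝ)..κ, H a *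
        Complex.exp (Complex.I * a * s)) κ := by
      have h3 := (intervalIntegral.continuousOn_primitive h1).continuousAt
        (Icc_mem_nhds hκ' (lt_add_one κ))
      refine h3.congr ?_
      filter_upwards [lt_mem_nhds hκ'] with k hk
      rw [intervalIntegral.integral_of_le hk.le]
    exact ((by fun_prop : ContinuousAt (fun κ : ℝ => Complex.exp (-(Complex.I * κ * s))) κ).mul
      h2).continuousWithinAt
  -- Continuity upgrades the almost everywhere equality, so the limit can be taken along all `K`.
  have heq : EqOn Φ Ψ (Ioi 0) :=
    Measure.eqOn_open_of_ae_eq hae isOpen_Ioi hΦc hΨc.continuousOn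
  have hΨ0 : Tendsto Ψ atTop (𝓝 0) := by
    simpa using (tendsto_integral_exp_neg g).const_mul (Complex.I / (2 * Real.pi))
  rw [AmplitudeFormulaAt, hs, tendsto_zero_iff_norm_tendsto_zero]
  refine (tendsto_zero_iff_norm_tendsto_zero.1 hΨ0).congr' ?_
  filter_upwards [eventually_gt_atTop 0] with κ hκ
  rw [← heq hκ, hΦ, norm_mul, Complex.norm_exp]
  simp

/-- Subtracting `f(s) i/(z - s + i)` reduces to a zero at `s`. The amplitude of the subtracted term
is `f(s) e^{-iκs} e^{-κ}`, for which (1) converges absolutely on the real line too. -/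
theorem IsFourierAmplitude.amplitudeFormulaAt_real {f : ℂ → ℂ} {C : ℝ}
    (hf : HasHalfPlaneDecay f C) {F : ℝ → ℂ} (hF : IsFourierAmplitude f F) {s : ℝ}
    (hd : DifferentiableAt ℝ (fun r : ℝ => f r) s) : AmplitudeFormulaAt f F s := by
  set v : ℂ := s - Complex.I with hv
  have him : ∀ z : ℂ, (z - v).im = z.im + 1 := fun z => by simp [hv]
  have hne : ∀ z : ℂ, 0 ≤ z.im → z - v ≠ 0 := fun z hz h => by
    have := congrArg Complex.im h
    rw [him, Complex.zero_im] at this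
    linarith
  set k : ℂ → ℂ := fun z => f s * Complex.I * (z - v)⁻¹ with hk
  set κ₀ : ℝ → ℂ := fun κ => f s * Complex.exp (-(Complex.I * v * κ)) with hκ₀
  have hkd : ∀ z : ℂ, 0 ≤ z.im → DifferentiableAt ℂ k z := fun z hz =>
    ((by fun_prop : DifferentiableAt ℂ (fun z => z - v) z).fun_inv (hne z hz)).const_mul _
  have hkD : HasHalfPlaneDecay k (‖f s * Complex.I‖ * ((1 + ‖v‖) / 1 + 1)) := by
    refine ⟨fun z hz => (hkd z hz).continuousAt.continuousWithinAt,
      fun z (hz : 0 < z.im) => (hkd z hz.le).differentiableWithinAt, fun z hz => ?_⟩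
    rw [hk, norm_mul, mul_div_assoc]
    gcongr
    refine norm_inv_sub_le one_pos ?_
    rw [him]
    exact le_trans (by linarith) (le_abs_self _)
  have hfk : HasHalfPlaneDecay (fun z => f z - k z)
      (C + ‖f s * Complex.I‖ * ((1 + ‖v‖) / 1 + 1)) :=
    ⟨hf.continuousOn.sub hkD.continuousOn, hf.differentiableOn.sub hkD.differentiableOn,
      fun z hz => (norm_sub_le _ _).trans ((add_le_add (hf.bound z hz)
        (hkD.bound z hz)).trans_eq (add_div _ _ _).symm)⟩
  have hexp : ∀ (θ : ℂ) (κ : ℝ), κ₀ κ * Complex.exp (Complex.I * κ * θ)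
      = f s * Complex.exp (Complex.I * (θ - v) * κ) := fun θ κ => by
    rw [hκ₀]
    simp only
    rw [mul_assoc, ← Complex.exp_add]
    congr 2
    ring
  have hka : ∀ θ : ℂ, 0 ≤ θ.im →
      IntegrableOn (fun κ : ℝ => κ₀ κ * Complex.exp (Complex.I * κ * θ)) (Ioi 0) ∧
      k θ = ∫ κ in Ioi (0 : ℝ), κ₀ κ * Complex.exp (Complex.I * κ * θ) := fun θ hθ => by
    have hre : (Complex.I * (θ - v)).re < 0 := by
      rw [Complex.I_mul_re, him]
      linarith
    simp only [hexp]
    refine ⟨(integrableOn_exp_mul_complex_Ioi hre 0).const_mul _, ?_⟩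
    rw [integral_const_mul, integral_exp_mul_complex_Ioi hre]
    have := hne θ hθ
    have hI := Complex.I_ne_zero
    simp only [hk, Complex.ofReal_zero, mul_zero, Complex.exp_zero]
    field_simp
    rw [Complex.I_sq, mul_neg_one]
  have hamp : IsFourierAmplitude (fun z => f z - k z) (fun κ => F κ - κ₀ κ) := fun θ hθ => by
    obtain ⟨h1, h2⟩ := hF θ hθ
    obtain ⟨h3, h4⟩ := hka θ hθ.le
    simp only [sub_mul]
    exact ⟨h1.sub h3, by rw [integral_sub h1 h3, h2, h4]⟩
  have hks : k s = f s := by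
    simp only [hk, hv]
    rw [sub_sub_cancel, mul_assoc, mul_inv_cancel₀ Complex.I_ne_zero, mul_one]
  have hdk : DifferentiableAt ℝ (fun r : ℝ => k r) s := by
    have h1 : DifferentiableAt ℝ k (s : ℂ) := (hkd s (by simp)).restrictScalars ℝ
    exact h1.comp s Complex.ofRealCLM.differentiableAt
  have h0 := hamp.amplitudeFormulaAt_zero hfk (by rw [hks, sub_self]) (hd.sub hdk)
  have h1 : Tendsto (fun K : ℝ => ∫ κ in (0 : ℝ)..K, κ₀ κ * Complex.exp (Complex.I * κ * s))
      atTop (𝓝 (k s)) := by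
    obtain ⟨h3, h4⟩ := hka s (by simp)
    rw [h4]
    exact intervalIntegral_tendsto_integral_Ioi 0 h3 tendsto_id
  have h2 := h0.add h1
  rw [sub_add_cancel] at h2
  refine h2.congr' ?_
  filter_upwards [eventually_gt_atTop 0] with K hK
  have hI : ∀ {G : ℝ → ℂ}, IntegrableOn G (Ioc 0 K) →
      IntervalIntegrable (fun κ : ℝ => G κ * Complex.exp (Complex.I * κ * s)) volume 0 K :=
    fun hG => ((intervalIntegrable_iff_integrableOn_Ioc_of_le hK.le).2 hG).mul_continuousOn
      (by fun_prop)
  rw [← intervalIntegral.integral_add (hI (hamp.integrableOn_Ioc K))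
    ((intervalIntegrable_iff_integrableOn_Ioc_of_le hK.le).2
      ((hka s (by simp)).1.mono_set Ioc_subset_Ioi_self))]
  refine intervalIntegral.integral_congr fun κ _ => ?_
  ring

/-! ### Assembly of the four assertions -/

theorem mainTheorem3 (c τ : ℝ) (hc : 0 < c) (hτ : 0 < τ) :
    -- every waveform has a Fourier amplitude, unique almost everywhere on the half-line, which also
    -- represents it at the real points of differentiability if it is continuous up to the real line
    (∀ f : ℂ → ℂ, IsWaveform f →
      ∃ F : ℝ → ℂ, IsFourierAmplitude f F ∧
        (∀ G : ℝ → ℂ, IsFourierAmplitude f G → G =ᵐ[volume.restrict (Ioi 0)] F) ∧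
        (ContinuousOn f {θ : ℂ | 0 ≤ θ.im} →
          ∀ s : ℝ, DifferentiableAt ℝ (fun r : ℝ => f (r : ℂ)) s →
            AmplitudeFormulaAt f F (s : ℂ))) ∧
    -- conversely, amplitudes of class L^p define analytic waveforms
    (∀ (p : ℝ≥0∞) (F : ℝ → ℂ), 1 ≤ p → p ≠ ⊤ → MemLp F p (volume.restrict (Ioi 0)) →
      ∃ f : ℂ → ℂ, DifferentiableOn ℂ f {θ : ℂ | 0 < θ.im} ∧ IsFourierAmplitude f F) ∧
    -- the quasi-spherical wave is a Fourier-Bessel integral with the stated weight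
    (∀ (f : ℂ → ℂ) (F : ℝ → ℂ), IsFourierAmplitude f F →
      (IsWaveform f ∨
        ∃ p : ℝ≥0∞, 1 ≤ p ∧ p ≠ ⊤ ∧ MemLp F p (volume.restrict (Ioi 0))) →
      ∀ t x y z : ℝ,
        (0 < axialDist x y ∨ AmplitudeFormulaAt f F (phase c τ t x y z)) →
        HasCylindrical c τ F (axialDist x y) z t (quasiSpherical c τ f t x y z) ∧
        HasFourierBessel c (fbWeight c τ F) (axialDist x y) z t
          (quasiSpherical c τ f t x y z)) ∧
    -- for integrable amplitudes the Fourier-Bessel integral converges absolutely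
    (∀ (f : ℂ → ℂ) (F : ℝ → ℂ), IsFourierAmplitude f F → IntegrableOn F (Ioi 0) →
      ∀ t x y z : ℝ,
        (0 < axialDist x y ∨ AmplitudeFormulaAt f F (phase c τ t x y z)) →
        HasAbsFourierBessel c (fbWeight c τ F) (axialDist x y) z t
          (quasiSpherical c τ f t x y z)) := by
  -- By uniqueness any amplitude of a waveform inherits square integrability, so waveforms fall
  -- under `p = 2`.
  have hL2 : ∀ f : ℂ → ℂ, IsWaveform f → ∀ F : ℝ → ℂ, IsFourierAmplitude f F →
      MemLp F 2 (volume.restrict (Ioi 0)) := fun f hf F hF => by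
    obtain ⟨G, hG, hG2⟩ := hf.exists_amplitude
    exact hG2.ae_eq (hG.ae_eq hF)
  have hformula : ∀ (f : ℂ → ℂ) (F : ℝ → ℂ), IsFourierAmplitude f F → ∀ t x y z : ℝ,
      (0 < axialDist x y ∨ AmplitudeFormulaAt f F (phase c τ t x y z)) →
      AmplitudeFormulaAt f F (phase c τ t x y z) := fun f F hF t x y z h =>
    h.elim (fun hρ => hF.amplitudeFormulaAt (phase_im_pos hc hτ z hρ)) id
  have hwave : ∀ (p : ℝ≥0∞) (f : ℂ → ℂ) (F : ℝ → ℂ), IsFourierAmplitude f F → 1 ≤ p → p ≠ ⊤ →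
      MemLp F p (volume.restrict (Ioi 0)) → ∀ t x y z : ℝ,
      (0 < axialDist x y ∨ AmplitudeFormulaAt f F (phase c τ t x y z)) →
      HasCylindrical c τ F (axialDist x y) z t (quasiSpherical c τ f t x y z) :=
    fun p f F hF hp hp' hFp t x y z h =>
      hasCylindrical_of_tendsto hc hτ hF.integrableOn_Ioc
        (tendsto_integral_norm_mul_exp_sub hp hp' hFp (mul_pos hc hτ)) t x y z
        (hformula f F hF t x y z h)
  refine ⟨fun f hf => ?_, fun p F hp hp' hF => exists_isFourierAmplitude_of_memLp hp hp' hF,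
    fun f F hF hor t x y z h => ?_, fun f F hF hF1 t x y z h => ?_⟩
  · obtain ⟨F, hF, -⟩ := hf.exists_amplitude
    refine ⟨F, hF, fun G hG => hG.ae_eq hF, fun hcont s hs => ?_⟩
    obtain ⟨C, hC⟩ := hf.exists_hasHalfPlaneDecay hcont
    exact hF.amplitudeFormulaAt_real hC hs
  · have hcyl : HasCylindrical c τ F (axialDist x y) z t (quasiSpherical c τ f t x y z) := by
      rcases hor with hf | ⟨p, hp, hp', hFp⟩
      · exact hwave 2 f F hF one_le_two ENNReal.ofNat_ne_top (hL2 f hf F hF) t x y z h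
      · exact hwave p f F hF hp hp' hFp t x y z h
    exact ⟨hcyl, hcyl.hasFourierBessel hc⟩
  · have hcyl := hwave 1 f F hF le_rfl ENNReal.one_ne_top (memLp_one_iff_integrable.2 hF1) t x y z h
    exact (hcyl.hasFourierBessel hc).hasAbsFourierBessel hc hτ hF1
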